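/- Let $\nu$ be a positive integer and let $\mathcal A$ be the Fermion (CAR) algebra over the lattice $\mathbb Z^\nu$: a non-zero unital $C^*$-algebra generated by elements $a_i$ ($i\in\mathbb Z^\nu$) and their adjoints $a_i^*$ satisfying the canonical anticommutation relations $$a_i^*a_j+a_ja_i^*=\delta_{i,j}\mathbf 1,\qquad a_i^*a_j^*+a_j^*a_i^*=a_ia_j+a_ja_i=0 .$$ For $\mathrm I\subset\mathbb Z^\nu$ let $\mathcal A(\mathrm I)$ be the $C^*$-subalgebra of $\mathcal A$ generated by $\mathbf 1$ and the $a_i,a_i^*$ with $i\in\mathrm I$ (so $\mathcal A(\emptyset)=\mathbb C\mathbf 1$). Let $\Theta$ be the unique $*$-automorphism of $\mathcal A$ with $\Theta(a_i)=-a_i$ for all $i$; it maps each $\mathcal A(\mathrm I)$ onto itself, and a state $\psi$ of $\mathcal A(\mathrm I)$ (a positive linear functional with $\psi(\mathbf 1)=1$) is called $\Theta$-even if $\psi(\Theta(A))=\psi(A)$ for all $A\in\mathcal A(\mathrm I)$. Let $\{\mathrm I_i\}$ be a (finite or infinite) family of mutually disjoint subsets of $\mathbb Z^\nu$, let $\varphi_i$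 be a state of $\mathcal A(\mathrm I_i)$ for each $i$, and let $\mathrm I=\bigcup_i\mathrm I_i$. Consider, for a state $\varphi$ of $\mathcal A(\mathrm I)$, the product property $$\varphi(A_{i_1}\cdots A_{i_n})=\prod_{j=1}^n\varphi_{i_j}(A_{i_j})\quad\text{for all } n,\text{ all distinct indices } i_1,\dots,i_n \text{ and all } A_{i_j}\in\mathcal A(\mathrm I_{i_j}).\tag{$*$}$$ 1. If all the states $\varphi_i$, except for at most one, are $\Theta$-even, then there exists a state $\varphi$ of $\mathcal A(\mathrm I)$ satisfying $(*)$. 2. Without any evenness assumption, there is at most one state $\varphi$ of $\mathcal A(\mathrm I)$ satisfying $(*)$. -/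

import Mathlib

open scoped ComplexOrder Topology

namespace FermionLattice

/-- `a : Λ → A` exhibits the unital C⋆-algebra `A` as the Fermion (CAR) algebra over the set of
sites `Λ`: `a i` is the annihilation operator at the site `i`, its adjoint `star (a i)` is the
creation operator, the canonical anticommutation relations hold, and `A` is generated, as a
C⋆-algebra, by these operators. The zero algebra is excluded. -/
structure IsFermionAlgebra {Λ A : Type*} [DecidableEq Λ] [CStarAlgebra A] (a : Λ → A) : Prop where
  one_ne_zero : (1 : A) ≠ 0
  star_anticomm : ∀ i j, star (a i) * a j + a j * star (a i) = if i = j then 1 else 0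
  star_anticomm_star : ∀ i j, star (a i) * star (a j) + star (a j) * star (a i) = 0
  anticomm : ∀ i j, a i * a j + a j * a i = 0
  generates : (StarAlgebra.adjoin ℂ (Set.range a)).topologicalClosure = ⊤

/-- The C⋆-subalgebra `A(I)` of `A` generated by `a i`, `star (a i)` for `i ∈ I`
(which is `ℂ 1` for `I = ∅`). -/
def localAlgebra {Λ A : Type*} [CStarAlgebra A] (a : Λ → A) (I : Set Λ) : StarSubalgebra ℂ A :=
  (StarAlgebra.adjoin ℂ (a '' I)).topologicalClosure

theorem localAlgebra_mono {Λ A : Type*} [CStarAlgebra A] (a : Λ → A) {I J : Set Λ} (h : I ⊆ J) :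
    localAlgebra a I ≤ localAlgebra a J :=
  StarSubalgebra.topologicalClosure_mono (StarAlgebra.adjoin_mono (Set.image_mono h))

/-- A state of a unital ⋆-subalgebra `S`: a positive linear functional with value `1` at `1`. -/
structure State {A : Type*} [CStarAlgebra A] (S : StarSubalgebra ℂ A) where
  toFun : S →ₗ[ℂ] ℂ
  nonneg : ∀ x : S, 0 ≤ toFun (star x * x)
  map_one : toFun 1 = 1

section Parity

variable {Λ A : Type*} [DecidableEq Λ] [CStarAlgebra A] {a : Λ → A}

theorem IsFermionAlgebra.exists_signUnitary (ha : IsFermionAlgebra a) (i : Λ) :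
    ∃ v : A, star v = v ∧ v * v = 1 ∧ v * a i * v = - a i ∧ ∀ j, j ≠ i → v * a j * v = a j := by
  have h1 : star (a i) * a i + a i * star (a i) = 1 := by simpa using ha.star_anticomm i i
  have h2 : a i * a i = 0 := by
    have h := ha.anticomm i i
    rw [← two_smul ℂ] at h
    exact (smul_eq_zero.mp h).resolve_left two_ne_zero
  have h3 : a i * star (a i) = 1 - star (a i) * a i := by rw [← h1]; abel
  have h4 : a i * (star (a i) * a i) = a i := by
    rw [← mul_assoc, h3, sub_mul, one_mul, mul_assoc, h2, mul_zero, sub_zero]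
  have h5 : (star (a i) * a i) * a i = 0 := by rw [mul_assoc, h2, mul_zero]
  have h6 : (star (a i) * a i) * (star (a i) * a i) = star (a i) * a i := by
    rw [mul_assoc, h4]
  have hv : (1 - (2 : ℂ) • (star (a i) * a i)) * (1 - (2 : ℂ) • (star (a i) * a i)) = 1 := by
    simp only [sub_mul, mul_sub, one_mul, mul_one, smul_mul_assoc, mul_smul_comm, h6]
    module
  refine ⟨1 - (2 : ℂ) • (star (a i) * a i), ?_, hv, ?_, ?_⟩
  · simp [star_smul]
  · simp only [sub_mul, mul_sub, one_mul, mul_one, smul_mul_assoc, mul_smul_comm, h4, h5,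
      smul_zero, sub_zero]
    module
  · intro j hj
    have e1 : a i * a j = - (a j * a i) := eq_neg_of_add_eq_zero_left (ha.anticomm i j)
    have e2 : star (a i) * a j = - (a j * star (a i)) :=
      eq_neg_of_add_eq_zero_left (by simpa [hj.symm] using ha.star_anticomm i j)
    have e3 : (star (a i) * a i) * a j = a j * (star (a i) * a i) := by
      rw [mul_assoc, e1, mul_neg, ← mul_assoc, e2, neg_mul, neg_neg, mul_assoc]
    have e4 : (1 - (2 : ℂ) • (star (a i) * a i)) * a j
        = a j * (1 - (2 : ℂ) • (star (a i) * a i)) := by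
      simp only [sub_mul, mul_sub, one_mul, mul_one, smul_mul_assoc, mul_smul_comm, e3]
    rw [e4, mul_assoc, hv, mul_one]

theorem IsFermionAlgebra.exists_partialParity (ha : IsFermionAlgebra a) (s : Finset Λ) :
    ∃ T : A →⋆ₐ[ℂ] A, ∀ j, T (a j) = if j ∈ s then - a j else a j := by
  induction s using Finset.induction_on with
  | empty => exact ⟨StarAlgHom.id ℂ A, by simp⟩
  | insert i s hi ih =>
    obtain ⟨T, hT⟩ := ih
    obtain ⟨v, hs, hv, h1, h2⟩ := ha.exists_signUnitary i
    refine ⟨(StarAlgEquiv.toStarAlgHom (Unitary.conjStarAlgAut ℂ A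
      ⟨v, Unitary.mem_iff.mpr ⟨by rw [hs, hv], by rw [hs, hv]⟩⟩)).comp T, fun j => ?_⟩
    rcases eq_or_ne j i with rfl | hj
    · simp [hT, hi, hs, h1]
    · by_cases hjs : j ∈ s
      · simp [hT, hjs, hs, h2 j hj]
      · simp [hT, hjs, hj, hs, h2 j hj]

theorem IsFermionAlgebra.starAlgHom_ext (ha : IsFermionAlgebra a) {S T : A →⋆ₐ[ℂ] A}
    (h : ∀ i, S (a i) = T (a i)) : S = T := by
  have hc : ∀ U : A →⋆ₐ[ℂ] A, Continuous U := fun U =>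
    AddMonoidHomClass.continuous_of_bound U 1
      (by simpa only [one_mul] using NonUnitalStarAlgHom.norm_apply_le U)
  have hcl : IsClosed {x : A | S x = T x} := isClosed_eq (hc S) (hc T)
  have hle := StarSubalgebra.topologicalClosure_minimal (t := StarAlgHom.equalizer S T)
    (StarAlgHom.adjoin_le_equalizer S T (s := Set.range a) (by rintro _ ⟨i, rfl⟩; exact h i)) hcl
  rw [ha.generates] at hle
  exact StarAlgHom.ext fun x => hle (StarSubalgebra.mem_top (x := x))

/-- The even-oddness automorphism exists and is unique. -/
theorem IsFermionAlgebra.existsUnique_parity (ha : IsFermionAlgebra a) :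
    ∃! T : A ≃⋆ₐ[ℂ] A, ∀ i, T (a i) = - a i := by
  choose T hT using ha.exists_partialParity
  let L : Set A := {x | CauchySeq fun s => T s x}
  have hnorm : ∀ s x, ‖T s x‖ ≤ ‖x‖ := fun s x => NonUnitalStarAlgHom.norm_apply_le (T s) x
  have hcl : IsClosed L := by
    rw [← isSeqClosed_iff_isClosed]
    intro x y hx hxy
    refine Metric.cauchySeq_iff'.mpr fun ε hε => ?_
    obtain ⟨n, hn⟩ := ((Metric.tendsto_atTop.mp hxy) (ε / 3) (by positivity))
    have hn := hn n le_rfl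
    obtain ⟨s, hs⟩ := Metric.cauchySeq_iff'.mp (hx n) (ε / 3) (by positivity)
    refine ⟨s, fun t ht => ?_⟩
    have k1 : ∀ r, dist (T r (x n)) (T r y) < ε / 3 := fun r => by
      rw [dist_eq_norm, ← map_sub]
      exact (hnorm r _).trans_lt (by rwa [← dist_eq_norm])
    have := hs t ht
    calc dist (T t y) (T s y)
        ≤ dist (T t y) (T t (x n)) + dist (T t (x n)) (T s (x n)) + dist (T s (x n)) (T s y) :=
          dist_triangle4 _ _ _ _
      _ < ε / 3 + ε / 3 + ε / 3 := by
          have := k1 t; have := k1 s; rw [dist_comm (T t y)]; gcongr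
      _ = ε := by ring
  have hlim : ∀ x, x ∈ L ↔ ∃ y, Filter.Tendsto (fun s => T s x) Filter.atTop (𝓝 y) := fun x =>
    ⟨fun h => cauchySeq_tendsto_of_complete h, fun ⟨_, h⟩ => h.cauchySeq⟩
  have hgen : ∀ i, Filter.Tendsto (fun s => T s (a i)) Filter.atTop (𝓝 (- a i)) := fun i => by
    refine tendsto_const_nhds.congr' ?_
    filter_upwards [Filter.eventually_ge_atTop {i}] with s hs
    rw [hT, if_pos (by simpa using hs)]
  let S : StarSubalgebra ℂ A :=
    { carrier := L
      mul_mem' := by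
        intro x y hx hy
        obtain ⟨p, hp⟩ := (hlim x).mp hx
        obtain ⟨q, hq⟩ := (hlim y).mp hy
        exact (hlim _).mpr ⟨p * q, by simpa only [map_mul] using hp.mul hq⟩
      add_mem' := by
        intro x y hx hy
        obtain ⟨p, hp⟩ := (hlim x).mp hx
        obtain ⟨q, hq⟩ := (hlim y).mp hy
        exact (hlim _).mpr ⟨p + q, by simpa only [map_add] using hp.add hq⟩
      algebraMap_mem' := by
        intro c
        exact (hlim _).mpr ⟨algebraMap ℂ A c, by
          simpa only [AlgHomClass.commutes] using tendsto_const_nhds⟩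
      star_mem' := by
        intro x hx
        obtain ⟨p, hp⟩ := (hlim x).mp hx
        exact (hlim _).mpr ⟨star p, by simpa only [map_star] using hp.star⟩ }
  have hS : ∀ x, x ∈ L := by
    have hle := StarSubalgebra.topologicalClosure_minimal (t := S)
      (StarAlgebra.adjoin_le (S := S) (s := Set.range a)
        (by rintro _ ⟨i, rfl⟩; exact (hlim _).mpr ⟨_, hgen i⟩)) hcl
    rw [ha.generates] at hle
    exact fun x => hle (StarSubalgebra.mem_top (x := x))
  choose f hf using fun x => (hlim x).mp (hS x)
  let F : A →⋆ₐ[ℂ] A :=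
    { toFun := f
      map_one' := tendsto_nhds_unique (hf 1) (by simpa only [map_one] using tendsto_const_nhds)
      map_zero' := tendsto_nhds_unique (hf 0) (by simpa only [map_zero] using tendsto_const_nhds)
      map_mul' := fun x y => tendsto_nhds_unique (hf (x * y))
        (by simpa only [map_mul] using (hf x).mul (hf y))
      map_add' := fun x y => tendsto_nhds_unique (hf (x + y))
        (by simpa only [map_add] using (hf x).add (hf y))
      commutes' := fun c => tendsto_nhds_unique (hf _)
        (by simpa only [AlgHomClass.commutes] using tendsto_const_nhds)
      map_star' := fun x => tendsto_nhds_unique (hf (star x))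
        (by simpa only [map_star] using (hf x).star) }
  have hF : ∀ i, F (a i) = - a i := fun i => tendsto_nhds_unique (hf (a i)) (hgen i)
  have hFF : F.comp F = StarAlgHom.id ℂ A := ha.starAlgHom_ext fun i => by simp [hF]
  refine ⟨StarAlgEquiv.ofStarAlgHom F F hFF hFF, fun i => hF i, fun G hG => ?_⟩
  have : StarAlgEquiv.toStarAlgHom G = F :=
    ha.starAlgHom_ext fun i => by rw [hF]; exact hG i
  exact StarAlgEquiv.ext fun x => congrArg (fun U : A →⋆ₐ[ℂ] A => U x) this

/-- The even-oddness automorphism `Θ` of the Fermion algebra: the unique ⋆-automorphism with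
`Θ (a i) = - a i` for every site `i`. -/
noncomputable def parity (ha : IsFermionAlgebra a) : A ≃⋆ₐ[ℂ] A :=
  ha.existsUnique_parity.choose

theorem parity_apply (ha : IsFermionAlgebra a) (i : Λ) : parity ha (a i) = - a i :=
  ha.existsUnique_parity.choose_spec.1 i

/-- Each `A(I)` is mapped into itself by `Θ`. -/
theorem parity_mem (ha : IsFermionAlgebra a) {I : Set Λ} {x : A} (hx : x ∈ localAlgebra a I) :
    parity ha x ∈ localAlgebra a I := by
  let Θ : A →⋆ₐ[ℂ] A := StarAlgEquiv.toStarAlgHom (parity ha)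
  have hc : Continuous Θ :=
    AddMonoidHomClass.continuous_of_bound Θ 1
      (by simpa only [one_mul] using NonUnitalStarAlgHom.norm_apply_le Θ)
  have hcl : IsClosed (Θ ⁻¹' (localAlgebra a I : Set A)) :=
    (StarSubalgebra.isClosed_topologicalClosure _).preimage hc
  have hle : localAlgebra a I ≤ (localAlgebra a I).comap Θ := by
    refine StarSubalgebra.topologicalClosure_minimal (StarAlgebra.adjoin_le ?_) hcl
    rintro _ ⟨i, hi, rfl⟩
    show parity ha (a i) ∈ localAlgebra a I
    rw [parity_apply]
    exact neg_mem (StarSubalgebra.le_topologicalClosure _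
      (StarAlgebra.subset_adjoin ℂ _ (Set.mem_image_of_mem a hi)))
  exact hle hx

/-- A state `φ` of `A(I)` is `Θ`-even if it is invariant under the restriction of `Θ` to `A(I)`. -/
def State.IsEven (ha : IsFermionAlgebra a) {I : Set Λ} (φ : State (localAlgebra a I)) : Prop :=
  ∀ x : localAlgebra a I, φ.toFun ⟨parity ha x, parity_mem ha x.2⟩ = φ.toFun x

end Parity

/-- The product property: `φ (A₁ ⋯ Aₙ) = ∏ⱼ φ_{iⱼ} (Aⱼ)` for all distinct indices `i₁, …, iₙ`
(in any order) and all `Aⱼ ∈ A(I_{iⱼ})`, the product on the left being formed in `A(⋃ᵢ Iᵢ)`,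
in the indicated order. -/
def IsProductExtension {Λ A ι : Type*} [CStarAlgebra A] (a : Λ → A) (I : ι → Set Λ)
    (φs : ∀ i, State (localAlgebra a (I i))) (φ : State (localAlgebra a (⋃ i, I i))) : Prop :=
  ∀ (n : ℕ) (k : Fin n → ι), Function.Injective k →
    ∀ x : ∀ j : Fin n, localAlgebra a (I (k j)),
      φ.toFun (List.ofFn fun j : Fin n =>
        StarSubalgebra.inclusion (localAlgebra_mono a (Set.subset_iUnion I (k j))) (x j)).prod
      = ∏ j : Fin n, (φs (k j)).toFun (x j)


universe u

/-! The Fock representation: a Fermion algebra exists over every set of sites. -/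
section Fock

/-- `lp`-space over the occupation configurations. -/
noncomputable abbrev Fock (Λ : Type*) := lp (fun _ : Finset Λ => ℂ) 2

theorem summable_monomial {X : Type*} (g : X ≃ X) (w : X → ℝ) (hw : ∀ S, |w S| ≤ 1)
    (f : lp (fun _ : X => ℂ) 2) :
    Memℓp (fun S => (w S : ℂ) * f (g S)) 2 ∧
      ∑' S, ‖(w S : ℂ) * f (g S)‖ ^ (2 : ENNReal).toReal ≤ ‖f‖ ^ (2 : ENNReal).toReal := by
  have h2 : 0 < (2 : ENNReal).toReal := by norm_num
  have hf := lp.hasSum_norm h2 f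
  have hg : HasSum (fun S => ‖f (g S)‖ ^ (2 : ENNReal).toReal) (‖f‖ ^ (2 : ENNReal).toReal) :=
    (g.hasSum_iff (f := fun S => ‖f S‖ ^ (2 : ENNReal).toReal)).mpr hf
  have hle : ∀ S, ‖(w S : ℂ) * f (g S)‖ ^ (2 : ENNReal).toReal
      ≤ ‖f (g S)‖ ^ (2 : ENNReal).toReal := fun S => by
    refine Real.rpow_le_rpow (norm_nonneg _) ?_ h2.le
    rw [norm_mul, Complex.norm_real, Real.norm_eq_abs]
    exact mul_le_of_le_one_left (norm_nonneg _) (hw S)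
  have hs := Summable.of_nonneg_of_le (fun S => by positivity) hle hg.summable
  exact ⟨(memℓp_gen_iff h2).mpr hs, (hs.tsum_le_tsum hle hg.summable).trans hg.tsum_eq.le⟩

/-- The operator `f ↦ w · (f ∘ g)`. -/
noncomputable def monomialOp {X : Type*} (g : X ≃ X) (w : X → ℝ) (hw : ∀ S, |w S| ≤ 1) :
    lp (fun _ : X => ℂ) 2 →L[ℂ] lp (fun _ : X => ℂ) 2 :=
  LinearMap.mkContinuous
    { toFun := fun f => ⟨fun S => (w S : ℂ) * f (g S), (summable_monomial g w hw f).1⟩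
      map_add' := fun f f' => by
        ext S
        exact mul_add _ _ _
      map_smul' := fun c f => by
        ext S
        exact mul_left_comm _ _ _ } 1 (fun f => by
      rw [one_mul]
      exact lp.norm_le_of_tsum_le (by norm_num) (norm_nonneg f) (summable_monomial g w hw f).2)

theorem monomialOp_apply {X : Type*} (g : X ≃ X) (w : X → ℝ) (hw : ∀ S, |w S| ≤ 1)
    (f : lp (fun _ : X => ℂ) 2) (S : X) : monomialOp g w hw f S = (w S : ℂ) * f (g S) := rfl

theorem star_monomialOp {X : Type*} (g : X ≃ X) (hg : ∀ S, g (g S) = S) (w : X → ℝ)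
    (hw : ∀ S, |w S| ≤ 1) :
    star (monomialOp g w hw) = monomialOp g (fun S => w (g S)) (fun S => hw (g S)) := by
  symm
  rw [ContinuousLinearMap.star_eq_adjoint, ContinuousLinearMap.eq_adjoint_iff]
  intro x y
  rw [lp.inner_eq_tsum, lp.inner_eq_tsum, ← g.tsum_eq]
  refine tsum_congr fun S => ?_
  simp only [monomialOp_apply, hg, RCLike.inner_apply, map_mul, Complex.conj_ofReal]
  ring

variable {Λ : Type*} [LinearOrder Λ]

/-- Change the occupation of the site `i`. -/
def flipAt (i : Λ) : Finset Λ ≃ Finset Λ where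
  toFun S := symmDiff S {i}
  invFun S := symmDiff S {i}
  left_inv S := by simp
  right_inv S := by simp

theorem flipAt_flipAt (i : Λ) (S : Finset Λ) : flipAt i (flipAt i S) = S :=
  (flipAt i).left_inv S

theorem flipAt_comm (i j : Λ) (S : Finset Λ) : flipAt i (flipAt j S) = flipAt j (flipAt i S) :=
  symmDiff_right_comm S {j} {i}

/-- The matrix coefficients of the annihilation operator at `i`. -/
def annWeight (i : Λ) (S : Finset Λ) : ℝ :=
  if i ∈ S then 0 else ∏ k ∈ S, if k < i then -1 else 1

theorem mem_flipAt_self (i : Λ) (S : Finset Λ) : i ∈ flipAt i S ↔ i ∉ S := by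
  simp [flipAt, Finset.mem_symmDiff]

theorem annWeight_sq (i : Λ) (S : Finset Λ) :
    annWeight i S * annWeight i S = if i ∈ S then 0 else 1 := by
  unfold annWeight
  split_ifs
  · simp
  · rw [← Finset.prod_mul_distrib]
    exact Finset.prod_eq_one fun k _ => by split_ifs <;> norm_num

theorem abs_annWeight_le (i : Λ) (S : Finset Λ) : |annWeight i S| ≤ 1 := by
  rw [abs_le_one_iff_mul_self_le_one, annWeight_sq]
  split_ifs <;> norm_num

theorem annWeight_flipAt {i j : Λ} (h : j ≠ i) (S : Finset Λ) :
    annWeight i (flipAt j S) = (if j < i then -1 else 1) * annWeight i S := by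
  have hi : i ∈ flipAt j S ↔ i ∈ S := by
    simp [flipAt, Finset.mem_symmDiff, h.symm]
  unfold annWeight
  simp only [hi]
  split_ifs with h1 h2 h2
  · simp
  · simp
  all_goals
    by_cases hj : j ∈ S
    · have hS : flipAt j S = S.erase j := by
        ext k; simp only [flipAt, Equiv.coe_fn_mk, Finset.mem_symmDiff, Finset.mem_singleton,
          Finset.mem_erase]; grind
      rw [hS, ← Finset.mul_prod_erase S _ hj]
      simp [h2]
    · have hS : flipAt j S = insert j S := by
        ext k; simp only [flipAt, Equiv.coe_fn_mk, Finset.mem_symmDiff, Finset.mem_singleton,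
          Finset.mem_insert]; grind
      rw [hS, Finset.prod_insert hj]
      simp [h2]

/-- The annihilation operator at `i` on the Fock space. -/
noncomputable def fockAnn (i : Λ) : Fock Λ →L[ℂ] Fock Λ :=
  monomialOp (flipAt i) (annWeight i) (abs_annWeight_le i)

theorem fockAnn_anticomm (i j : Λ) :
    (fockAnn i : Fock Λ →L[ℂ] Fock Λ) * fockAnn j + fockAnn j * fockAnn i = 0 := by
  ext f S
  show (annWeight i S : ℂ) * ((annWeight j (flipAt i S) : ℂ) * f (flipAt j (flipAt i S)))
    + (annWeight j S : ℂ) * ((annWeight i (flipAt j S) : ℂ) * f (flipAt i (flipAt j S))) = 0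
  rw [flipAt_comm j i]
  rcases eq_or_ne i j with rfl | h
  · have : annWeight i S * annWeight i (flipAt i S) = 0 := by
      by_cases hi : i ∈ S
      · simp [annWeight, hi]
      · simp [annWeight, mem_flipAt_self, hi]
    have h' : (annWeight i S : ℂ) * annWeight i (flipAt i S) = 0 := by exact_mod_cast this
    rw [← mul_assoc, h']; simp
  · rw [annWeight_flipAt h, annWeight_flipAt h.symm]
    rcases lt_or_gt_of_ne h with h1 | h1
    · simp only [h1, h1.not_gt, if_true, if_false]; push_cast; ring
    · simp only [h1, h1.not_gt, if_true, if_false]; push_cast; ring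

theorem fockAnn_star_anticomm (i j : Λ) :
    star (fockAnn i : Fock Λ →L[ℂ] Fock Λ) * fockAnn j + fockAnn j * star (fockAnn i)
      = if i = j then 1 else 0 := by
  have hs : star (fockAnn i : Fock Λ →L[ℂ] Fock Λ) = _ :=
    star_monomialOp (flipAt i) (flipAt_flipAt i) (annWeight i) (abs_annWeight_le i)
  rw [hs]
  ext f S
  have key : ((monomialOp (flipAt i) (fun S => annWeight i (flipAt i S))
        (fun S => abs_annWeight_le i (flipAt i S)) * fockAnn j + fockAnn j *
        monomialOp (flipAt i) (fun S => annWeight i (flipAt i S))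
        (fun S => abs_annWeight_le i (flipAt i S)) : Fock Λ →L[ℂ] Fock Λ) f) S =
      (annWeight i (flipAt i S) : ℂ) * ((annWeight j (flipAt i S) : ℂ) * f (flipAt j (flipAt i S)))
      + (annWeight j S : ℂ) * ((annWeight i (flipAt i (flipAt j S)) : ℂ)
        * f (flipAt i (flipAt j S))) := rfl
  rw [key, flipAt_comm j i]
  rcases eq_or_ne i j with rfl | h
  · rw [if_pos rfl, flipAt_flipAt]
    have : annWeight i (flipAt i S) * annWeight i (flipAt i S)
        + annWeight i S * annWeight i S = 1 := by
      rw [annWeight_sq, annWeight_sq]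
      by_cases hi : i ∈ S <;> simp [mem_flipAt_self, hi]
    have h' : (annWeight i (flipAt i S) : ℂ) * annWeight i (flipAt i S)
        + (annWeight i S : ℂ) * annWeight i S = 1 := by exact_mod_cast this
    rw [← mul_assoc, ← mul_assoc, ← add_mul, h', one_mul]
    rfl
  · rw [if_neg h, flipAt_comm i j, annWeight_flipAt h.symm, annWeight_flipAt h]
    show _ = (0 : ℂ)
    rcases lt_or_gt_of_ne h with h1 | h1
    · simp only [h1, h1.not_gt, if_true, if_false]; push_cast; ring
    · simp only [h1, h1.not_gt, if_true, if_false]; push_cast; ring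

end Fock

/-- Over every set of sites there is a Fermion algebra. -/
theorem exists_isFermionAlgebra (Λ : Type u) [DecidableEq Λ] :
    ∃ (A : Type u) (_ : CStarAlgebra A) (a : Λ → A), IsFermionAlgebra a := by
  classical
  let _ : LinearOrder Λ := linearOrderOfSTO WellOrderingRel
  let S : StarSubalgebra ℂ (Fock Λ →L[ℂ] Fock Λ) :=
    (StarAlgebra.adjoin ℂ (Set.range fockAnn)).topologicalClosure
  have hS : IsClosed (S : Set (Fock Λ →L[ℂ] Fock Λ)) :=
    StarSubalgebra.isClosed_topologicalClosure _
  let inst : CStarAlgebra S := StarSubalgebra.cstarAlgebra S (h_closed := hS)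
  have hm : ∀ i, fockAnn i ∈ S := fun i => StarSubalgebra.le_topologicalClosure _
    (StarAlgebra.subset_adjoin ℂ _ (Set.mem_range_self i))
  let a : Λ → S := fun i => ⟨fockAnn i, hm i⟩
  refine ⟨S, inst, a, ?_, ?_, ?_, ?_, ?_⟩
  · intro h
    have h' : (1 : Fock Λ →L[ℂ] Fock Λ) = 0 := congrArg Subtype.val h
    have h1 := congrArg (fun T : Fock Λ →L[ℂ] Fock Λ => T (lp.single 2 ∅ (1 : ℂ)) ∅) h'
    have h2 : (lp.single 2 ∅ (1 : ℂ) : Fock Λ) ∅ = (0 : ℂ) := h1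
    simp at h2
  · intro i j
    apply Subtype.ext
    have := fockAnn_star_anticomm i j
    split_ifs with h
    · rw [if_pos h] at this; exact this
    · rw [if_neg h] at this; exact this
  · intro i j
    apply Subtype.ext
    have := congrArg star (fockAnn_anticomm j i)
    simp only [star_add, star_mul, star_zero] at this
    exact this
  · intro i j
    exact Subtype.ext (fockAnn_anticomm i j)
  · refine SetLike.coe_injective (Set.eq_univ_of_forall fun x => ?_)
    rw [StarSubalgebra.topologicalClosure_coe,
      Topology.IsInducing.subtypeVal.closure_eq_preimage_closure_image]
    have : Subtype.val '' (StarAlgebra.adjoin ℂ (Set.range a) : Set S)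
        = ((StarAlgebra.adjoin ℂ (Set.range fockAnn) : StarSubalgebra ℂ (Fock Λ →L[ℂ] Fock Λ)) :
          Set (Fock Λ →L[ℂ] Fock Λ)) := by
      have h := StarAlgHom.map_adjoin S.subtype (Set.range a)
      rw [← Set.range_comp] at h
      exact congrArg SetLike.coe h
    have hx : (x : Fock Λ →L[ℂ] Fock Λ) ∈ closure ((StarAlgebra.adjoin ℂ (Set.range fockAnn) :
        StarSubalgebra ℂ (Fock Λ →L[ℂ] Fock Λ)) : Set (Fock Λ →L[ℂ] Fock Λ)) := x.2
    rw [← this] at hx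
    exact hx

end FermionLattice

/-! Rewrite the algebra with self-adjoint anticommuting unitaries `c s`, two per site (`majorana`).
Conjugating by `c s` after `Θ` changes the sign of `c s` alone, and averaging this automorphism with
the identity gives a positive faithful projection `E_s` that removes `c s`. Composed over the
generators of a finite region `J`, these projections give a map `E_J` which is scalar-valued on
`A(J)`, the scalar being the normalized trace, and which is `A(K)`-bimodular for `K` disjoint from
`J`.

A state `f` of `A(J)` has a density `b²` for this trace. For any state `ω` of `A`, the functional
`ω'(x) = ω(E_J(b x b))` is a state extending `f`. If `f` is even then so is `b`; hence `b` commutes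
with `A(K)`, and `ω'(y z y') = ω(y y') f(z)` for `y, y'` in `A(K)` and `z` in `A(J)`
(`IsMajorana.exists_graft`).

Existence: graft the possible non-even state onto an arbitrary state, where only the extension
property is needed, then graft even states one at a time (`exists_finite_product`). This settles
finitely many sites and indices; a limit along an ultrafilter and density of the finitely localized
elements do the rest.

Uniqueness: `c s * x = Θ(x) * c s` for `x` localized away from `s`, so a generator can be moved
through a product of localized factors to the factor of its own region. Products over distinct
indices therefore span a dense subalgebra (`adjoin_le_span`), and states are continuous. -/

namespace FermionLattice

/-! ### Positive functionals on a unital C⋆-algebra. -/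

section PositiveFunctional

variable {B : Type*} [CStarAlgebra B]

theorem exists_positiveLinearMap (f : B →ₗ[ℂ] ℂ) (hf : ∀ x, 0 ≤ f (star x * x)) :
    letI := CStarAlgebra.spectralOrder B
    ∃ g : B →ₚ[ℂ] ℂ, ∀ x, g x = f x := by
  let _ := CStarAlgebra.spectralOrder B
  have _ := CStarAlgebra.spectralOrderedRing B
  have h0 : ∀ x : B, 0 ≤ x → 0 ≤ f x := fun x hx => by
    obtain ⟨y, rfl⟩ := CStarAlgebra.nonneg_iff_eq_star_mul_self.mp hx
    exact hf y
  exact ⟨{ f with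
    monotone' := fun x y hxy => by
      have := h0 (y - x) (sub_nonneg.mpr hxy)
      rw [map_sub] at this
      exact sub_nonneg.mp this }, fun x => rfl⟩

theorem map_star_of_map_star_mul_self_nonneg (f : B →ₗ[ℂ] ℂ) (hf : ∀ x, 0 ≤ f (star x * x))
    (x : B) : f (star x) = star (f x) := by
  let _ := CStarAlgebra.spectralOrder B
  have _ := CStarAlgebra.spectralOrderedRing B
  obtain ⟨g, hg⟩ := exists_positiveLinearMap f hf
  rw [← hg, ← hg, map_star]

/-- Every `x` is a combination of four positive elements of norm at most `‖x‖`. The factor 4 is not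
sharp, but the bound depends on `f` only through `f 1`, so it is uniform over states, as the
compactness argument in `exists_limit_state` requires. -/
theorem norm_apply_le_of_map_star_mul_self_nonneg (f : B →ₗ[ℂ] ℂ)
    (hf : ∀ x, 0 ≤ f (star x * x)) (x : B) : ‖f x‖ ≤ 4 * ‖f 1‖ * ‖x‖ := by
  let _ := CStarAlgebra.spectralOrder B
  have _ := CStarAlgebra.spectralOrderedRing B
  obtain ⟨g, hg⟩ := exists_positiveLinearMap f hf
  obtain ⟨y, hy0, hyn, hy⟩ := CStarAlgebra.exists_sum_four_nonneg x
  have h1 : f x = ∑ i : Fin 4, Complex.I ^ (i : ℕ) • f (y i) := by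
    conv_lhs => rw [hy]
    simp only [map_sum, map_smul]
  rw [h1]
  refine (norm_sum_le _ _).trans ?_
  refine (Finset.sum_le_sum (g := fun _ => ‖f 1‖ * ‖x‖) fun i _ => ?_).trans
    (by simp [mul_assoc])
  simp only [norm_smul, norm_pow, Complex.norm_I, one_pow, one_mul]
  rw [← hg, ← hg]
  exact (g.norm_apply_le_of_nonneg _ (hy0 i)).trans (by gcongr; exact hyn i)

theorem continuous_of_map_star_mul_self_nonneg (f : B →ₗ[ℂ] ℂ)
    (hf : ∀ x, 0 ≤ f (star x * x)) : Continuous f :=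
  AddMonoidHomClass.continuous_of_bound f _ (norm_apply_le_of_map_star_mul_self_nonneg f hf)

/-- Hahn–Banach gives `g` of norm one with `g 1 = 1`. For `x ≥ 0` the estimate `‖‖x‖·1 - x‖ ≤ ‖x‖`
forces `Re (g x) ≥ 0`, and averaging `g` with its conjugate `x ↦ star (g (star x))` leaves exactly
this real part on self-adjoint elements. -/
theorem exists_unital_positive_functional [Nontrivial B] :
    ∃ f : B →ₗ[ℂ] ℂ, (∀ x, 0 ≤ f (star x * x)) ∧ f 1 = 1 := by
  let _ := CStarAlgebra.spectralOrder B
  have _ := CStarAlgebra.spectralOrderedRing B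
  obtain ⟨g, hg, hg1⟩ := exists_dual_vector ℂ (1 : B) (by simp)
  have hg1 : g 1 = 1 := by simpa using hg1
  have hpos : ∀ x : B, 0 ≤ x → 0 ≤ (g x).re := fun x hx => by
    have hle : x ≤ algebraMap ℝ B ‖x‖ := IsSelfAdjoint.le_algebraMap_norm_self (.of_nonneg hx)
    have h1 : ‖algebraMap ℝ B ‖x‖ - x‖ ≤ ‖x‖ := by
      refine (CStarAlgebra.norm_le_norm_of_nonneg_of_le (sub_nonneg.mpr hle)
        (sub_le_self _ hx)).trans ?_
      simp
    have h2 := (Complex.re_le_norm _).trans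
      ((g.le_opNorm (algebraMap ℝ B ‖x‖ - x)).trans_eq (by rw [hg, one_mul]))
    have h3 : g (algebraMap ℝ B ‖x‖) = (‖x‖ : ℂ) := by
      rw [Algebra.algebraMap_eq_smul_one, ← Complex.coe_smul, map_smul, hg1, smul_eq_mul, mul_one]
    rw [map_sub, h3, Complex.sub_re, Complex.ofReal_re] at h2
    linarith
  refine ⟨{ toFun := fun x => (2 : ℂ)⁻¹ * (g x + star (g (star x)))
            map_add' := fun x y => by simp; ring
            map_smul' := fun c x => by simp; ring }, fun x => ?_, ?_⟩
  · have h := hpos _ (star_mul_self_nonneg x)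
    have : (2 : ℂ)⁻¹ * (g (star x * x) + star (g (star (star x * x))))
        = ((g (star x * x)).re : ℂ) := by
      rw [star_mul, star_star, ← starRingEnd_apply, Complex.add_conj]
      push_cast
      ring
    show 0 ≤ (2 : ℂ)⁻¹ * (g (star x * x) + star (g (star (star x * x))))
    rw [this]
    exact_mod_cast h
  · show (2 : ℂ)⁻¹ * (g 1 + star (g (star 1))) = 1
    rw [star_one, hg1, star_one]
    norm_num

end PositiveFunctional

/-! ### Closed subalgebras generated by a set of generators. -/

section LocalAlgebra

variable {M A : Type*} [CStarAlgebra A]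

theorem isClosed_localAlgebra (c : M → A) (G : Set M) : IsClosed (localAlgebra c G : Set A) :=
  StarSubalgebra.isClosed_topologicalClosure _

theorem mem_localAlgebra {c : M → A} {G : Set M} {s : M} (hs : s ∈ G) : c s ∈ localAlgebra c G :=
  StarSubalgebra.le_topologicalClosure _
    (StarAlgebra.subset_adjoin ℂ _ (Set.mem_image_of_mem c hs))

theorem localAlgebra_le {c : M → A} {G : Set M} {S : StarSubalgebra ℂ A}
    (hS : IsClosed (S : Set A)) (h : ∀ s ∈ G, c s ∈ S) : localAlgebra c G ≤ S :=
  StarSubalgebra.topologicalClosure_minimal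
    (StarAlgebra.adjoin_le (by rintro _ ⟨s, hs, rfl⟩; exact h s hs)) hS

theorem continuous_starAlgHom (T : A →⋆ₐ[ℂ] A) : Continuous T :=
  AddMonoidHomClass.continuous_of_bound T 1
    (by simpa only [one_mul] using NonUnitalStarAlgHom.norm_apply_le T)

theorem starAlgHom_eq_on_localAlgebra {c : M → A} {G : Set M} (S T : A →⋆ₐ[ℂ] A)
    (h : ∀ s ∈ G, S (c s) = T (c s)) {x : A} (hx : x ∈ localAlgebra c G) : S x = T x := by
  have hcl : IsClosed (StarAlgHom.equalizer S T : Set A) :=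
    isClosed_eq (continuous_starAlgHom S) (continuous_starAlgHom T)
  exact localAlgebra_le hcl h hx

theorem map_mem_localAlgebra {c : M → A} {G : Set M} (T : A →⋆ₐ[ℂ] A)
    (h : ∀ s ∈ G, T (c s) ∈ localAlgebra c G) {x : A} (hx : x ∈ localAlgebra c G) :
    T x ∈ localAlgebra c G := by
  have hcl : IsClosed ((localAlgebra c G).comap T : Set A) :=
    (isClosed_localAlgebra c G).preimage (continuous_starAlgHom T)
  exact localAlgebra_le hcl h hx

/-- The scalars are a finite-dimensional, hence closed, subspace, so taking the closure adds
nothing. This starts the inductions over lists of generators. -/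
theorem exists_eq_algebraMap_of_mem_localAlgebra_empty {c : M → A} {x : A}
    (hx : x ∈ localAlgebra c ∅) : ∃ z : ℂ, x = algebraMap ℂ A z := by
  have hcl : IsClosed ((⊥ : StarSubalgebra ℂ A) : Set A) := by
    have : ((⊥ : StarSubalgebra ℂ A) : Set A) = (LinearMap.range (Algebra.linearMap ℂ A)) := by
      ext y
      simp
    rw [this]
    exact Submodule.closed_of_finiteDimensional _
  have := localAlgebra_le (c := c) (G := ∅) hcl (by simp) hx
  obtain ⟨z, hz⟩ := StarSubalgebra.mem_bot.mp this
  exact ⟨z, hz.symm⟩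

end LocalAlgebra

/-! ### Majorana generators, sign flips and conditional expectations. -/

/-- Self-adjoint anticommuting unitaries, with the automorphism changing all their signs. -/
structure IsMajorana {M A : Type*} [CStarAlgebra A] (c : M → A) (T : A →⋆ₐ[ℂ] A) : Prop where
  star_eq : ∀ s, star (c s) = c s
  mul_self : ∀ s, c s * c s = 1
  anticomm : ∀ s t, s ≠ t → c s * c t = -(c t * c s)
  map_eq : ∀ s, T (c s) = -c s
  map_map : ∀ x, T (T x) = x

namespace IsMajorana

variable {M A : Type*} [CStarAlgebra A] {c : M → A} {T : A →⋆ₐ[ℂ] A}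

/-- The automorphism changing the sign of the generator `c s` only. -/
noncomputable def flip (h : IsMajorana c T) (s : M) : A →⋆ₐ[ℂ] A :=
  -- Conjugation by `c s` fixes `c s` and negates every other generator; composing with `T` reverses
  -- all these signs.
  (StarAlgEquiv.toStarAlgHom (Unitary.conjStarAlgAut ℂ A ⟨c s, Unitary.mem_iff.mpr
    ⟨by rw [h.star_eq, h.mul_self], by rw [h.star_eq, h.mul_self]⟩⟩)).comp T

theorem flip_apply (h : IsMajorana c T) (s : M) (x : A) : h.flip s x = c s * T x * c s := by
  simp [flip, h.star_eq]

theorem mul_mul_self (h : IsMajorana c T) (s : M) (x : A) : x * c s * c s = x := by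
  rw [mul_assoc, h.mul_self, mul_one]

theorem self_mul_mul (h : IsMajorana c T) (s : M) (x : A) : c s * (c s * x) = x := by
  rw [← mul_assoc, h.mul_self, one_mul]

theorem flip_self (h : IsMajorana c T) (s : M) : h.flip s (c s) = -c s := by
  rw [flip_apply, h.map_eq, mul_neg, neg_mul, h.mul_mul_self]

theorem flip_of_ne (h : IsMajorana c T) {s t : M} (hst : s ≠ t) : h.flip s (c t) = c t := by
  rw [flip_apply, h.map_eq, mul_neg, h.anticomm s t hst, neg_neg, h.mul_mul_self]

theorem flip_flip_apply (h : IsMajorana c T) (s t : M) (x : A) :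
    h.flip s (h.flip t x) = c s * (c t * x * c t) * c s := by
  rw [flip_apply, flip_apply]
  simp only [map_mul, h.map_eq, h.map_map, mul_neg, neg_mul, neg_neg]

theorem flip_flip (h : IsMajorana c T) (s : M) (x : A) : h.flip s (h.flip s x) = x := by
  rw [flip_flip_apply, ← mul_assoc, ← mul_assoc, h.mul_self, one_mul, h.mul_mul_self]

theorem flip_comm (h : IsMajorana c T) (s t : M) (x : A) :
    h.flip s (h.flip t x) = h.flip t (h.flip s x) := by
  rcases eq_or_ne s t with rfl | hst
  · rfl
  rw [flip_flip_apply, flip_flip_apply]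
  calc c s * (c t * x * c t) * c s = c s * c t * x * (c t * c s) := by simp only [mul_assoc]
    _ = c t * c s * x * (c s * c t) := by
      rw [h.anticomm s t hst]
      simp only [mul_neg, neg_mul]
    _ = c t * (c s * x * c s) * c t := by simp only [mul_assoc]

theorem map_flip (h : IsMajorana c T) (s : M) (x : A) : T (h.flip s x) = h.flip s (T x) := by
  rw [flip_apply, flip_apply]
  simp only [map_mul, h.map_eq, mul_neg, neg_mul, neg_neg]

theorem flip_eq_self (h : IsMajorana c T) {G : Set M} {s : M} (hs : s ∉ G)
    {x : A} (hx : x ∈ localAlgebra c G) :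
    h.flip s x = x :=
  starAlgHom_eq_on_localAlgebra (h.flip s) (StarAlgHom.id ℂ A)
    (fun _ ht => h.flip_of_ne (fun e => hs (e ▸ ht))) hx

theorem map_mem (h : IsMajorana c T) {G : Set M}
    {x : A} (hx : x ∈ localAlgebra c G) : T x ∈ localAlgebra c G :=
  map_mem_localAlgebra T (fun s hs => by rw [h.map_eq]; exact neg_mem (mem_localAlgebra hs)) hx

/-- Invariance of `x` under the flip at `s` reads `c s * T x * c s = x`; multiply by `c s` on the
left. All reorderings of odd generators rest on this twisted commutation. -/
theorem map_mul_gen (h : IsMajorana c T) {G : Set M} {s : M} (hs : s ∉ G)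
    {x : A} (hx : x ∈ localAlgebra c G) :
    T x * c s = c s * x := by
  conv_rhs => rw [← h.flip_eq_self hs hx, flip_apply, mul_assoc, h.self_mul_mul]

theorem gen_mul (h : IsMajorana c T) {G : Set M} {s : M} (hs : s ∉ G)
    {x : A} (hx : x ∈ localAlgebra c G) :
    c s * x = T x * c s := (h.map_mul_gen hs hx).symm

/-- Even elements commute with everything localized in a disjoint region. -/
theorem commute_of_map_eq (h : IsMajorana c T) {G K : Set M} (hGK : Disjoint G K) {b y : A}
    (hb : b ∈ localAlgebra c G) (hTb : T b = b) (hy : y ∈ localAlgebra c K) : b * y = y * b := by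
  have key : ∀ b' ∈ localAlgebra c G, T b' = b' → ∀ s ∈ K, b' * c s = c s * b' :=
    fun b' hb' hTb' s hs => by
      conv_lhs => rw [← hTb', h.map_mul_gen (fun hsG => hGK.le_bot ⟨hsG, hs⟩) hb']
  -- The star-centralizer consists of what commutes with both `b` and `star b`. Both are even, so it
  -- is a closed star-subalgebra containing the generators from `K`.
  have hcl : IsClosed (StarSubalgebra.centralizer ℂ {b} : Set A) := by
    have : (StarSubalgebra.centralizer ℂ {b} : Set A) = Set.centralizer {b, star b} := by
      ext z
      rw [SetLike.mem_coe, StarSubalgebra.mem_centralizer_iff]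
      simp [Set.mem_centralizer_iff]
    rw [this]
    exact Set.isClosed_centralizer _
  have := localAlgebra_le (c := c) (G := K) hcl (fun s hs => by
    rw [StarSubalgebra.mem_centralizer_iff]
    rintro _ rfl
    exact ⟨key _ hb hTb s hs, key _ (star_mem hb) (by rw [map_star, hTb]) s hs⟩) hy
  exact (StarSubalgebra.mem_centralizer_iff ℂ |>.mp this b rfl).1

/-- The conditional expectation onto the algebra of the generators other than `c s`. -/
noncomputable def expect (h : IsMajorana c T) (s : M) : A →L[ℂ] A :=
  (2 : ℂ)⁻¹ • (ContinuousLinearMap.id ℂ A +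
    ⟨(h.flip s).toAlgHom.toLinearMap, continuous_starAlgHom (h.flip s)⟩)

theorem expect_apply (h : IsMajorana c T) (s : M) (x : A) : h.expect s x = (2 : ℂ)⁻¹ •
    (x + h.flip s x) := rfl

theorem expect_flip_self (h : IsMajorana c T) (s : M) (x : A) : h.expect s
    (h.flip s x) = h.expect s x := by
  rw [expect_apply, expect_apply, flip_flip, add_comm]

theorem expect_flip (h : IsMajorana c T) (s t : M) (x : A) : h.expect s (h.flip t x) = h.flip t
    (h.expect s x) := by
  rw [expect_apply, expect_apply, map_smul, map_add, flip_comm]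

theorem map_expect (h : IsMajorana c T) (s : M) (x : A) : T (h.expect s x) = h.expect s (T x) := by
  rw [expect_apply, expect_apply, map_smul, map_add, map_flip]

theorem expect_of_flip_eq (h : IsMajorana c T) {s : M}
    {x : A} (hx : h.flip s x = x) : h.expect s x = x := by
  rw [expect_apply, hx]
  module

theorem expect_mul_mul (h : IsMajorana c T) {s : M} {y z : A} (hy : h.flip s y = y) (hz :
    h.flip s z = z) (x : A) :
    h.expect s (y * x * z) = y * h.expect s x * z := by
  simp only [expect_apply, map_mul, hy, hz, mul_smul_comm, smul_mul_assoc, mul_add, add_mul]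

theorem expect_mul_gen (h : IsMajorana c T) {s : M} {y : A} (hy : h.flip s y = y) : h.expect s
    (y * c s) = 0 := by
  rw [expect_apply, map_mul, hy, flip_self, mul_neg, add_neg_cancel, smul_zero]

/-- The expansion `x = u + v * c s`: the expectation extracts the flip-invariant part `u`, and right
multiplication by `c s` brings the coefficient `v` into that part. -/
theorem expect_add_expect_mul (h : IsMajorana c T) (s : M) (x : A) :
    h.expect s x + h.expect s (x * c s) * c s = x := by
  simp only [expect_apply, map_mul, flip_self, smul_mul_assoc, add_mul, mul_neg, neg_mul,
    h.mul_mul_self]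
  module

/-- Elements `u + v * c s` with `u, v` in `A(G)` multiply among themselves because `c s * u = T u *
c s`. Expressing the condition through the two coefficient maps, which are continuous, makes the set
of such elements visibly closed, so it contains the whole closed algebra. This drives the inductions
that remove one generator at a time. -/
theorem expect_mem_and_expect_mul_gen_mem (h : IsMajorana c T) {G : Set M} {s : M} (hs : s ∉ G)
    {x : A}
    (hx : x ∈ localAlgebra c (insert s G)) :
    h.expect s x ∈ localAlgebra c G ∧ h.expect s (x * c s) ∈ localAlgebra c G := by
  have key : ∀ u ∈ localAlgebra c G, ∀ v ∈ localAlgebra c G,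
      h.expect s (u + v * c s) = u ∧ h.expect s ((u + v * c s) * c s) = v := by
    intro u hu v hv
    have hu' := h.flip_eq_self hs hu
    have hv' := h.flip_eq_self hs hv
    constructor
    · rw [map_add, h.expect_of_flip_eq hu', h.expect_mul_gen hv', add_zero]
    · rw [add_mul, h.mul_mul_self, map_add, h.expect_of_flip_eq hv', h.expect_mul_gen hu',
        zero_add]
  have hmem : ∀ u ∈ localAlgebra c G, ∀ v ∈ localAlgebra c G,
      h.expect s (u + v * c s) ∈ localAlgebra c G ∧
        h.expect s ((u + v * c s) * c s) ∈ localAlgebra c G := fun u hu v hv => by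
    rwa [(key u hu v hv).1, (key u hu v hv).2, and_iff_right hu]
  let W : StarSubalgebra ℂ A :=
    { carrier := {x | h.expect s x ∈ localAlgebra c G ∧ h.expect s (x * c s) ∈ localAlgebra c G}
      mul_mem' := by
        rintro x y ⟨hx1, hx2⟩ ⟨hy1, hy2⟩
        rw [← h.expect_add_expect_mul s x, ← h.expect_add_expect_mul s y]
        have e : ∀ u v, ∀ u' ∈ localAlgebra c G, ∀ v' ∈ localAlgebra c G,
            (u + v * c s) * (u' + v' * c s) = (u * u' + v * T v') + (u * v' + v * T u') * c s := by
          intro u v u' hu' v' hv'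
          have e1 : v * c s * u' = v * T u' * c s := by
            rw [mul_assoc, h.gen_mul hs hu', mul_assoc]
          have e2 : v * c s * (v' * c s) = v * T v' := by
            rw [mul_assoc, ← mul_assoc (c s), h.gen_mul hs hv', h.mul_mul_self]
          rw [add_mul, mul_add, mul_add, e1, e2, add_mul, mul_assoc u v']
          abel
        rw [Set.mem_ofPred_eq, e _ _ _ hy1 _ hy2]
        exact hmem _ (add_mem (mul_mem hx1 hy1) (mul_mem hx2 (h.map_mem hy2))) _
          (add_mem (mul_mem hx1 hy2) (mul_mem hx2 (h.map_mem hy1)))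
      add_mem' := by
        rintro x y ⟨hx1, hx2⟩ ⟨hy1, hy2⟩
        refine ⟨?_, ?_⟩
        · rw [map_add]; exact add_mem hx1 hy1
        · rw [add_mul, map_add]; exact add_mem hx2 hy2
      algebraMap_mem' := by
        intro r
        have := hmem _ (algebraMap_mem (localAlgebra c G) r) _ (zero_mem _)
        rwa [zero_mul, add_zero] at this
      star_mem' := by
        rintro x ⟨hx1, hx2⟩
        rw [← h.expect_add_expect_mul s x, Set.mem_ofPred_eq, star_add, star_mul, h.star_eq,
          h.gen_mul hs (star_mem hx2)]
        exact hmem _ (star_mem hx1) _ (h.map_mem (star_mem hx2)) }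
  have hcl : IsClosed (W : Set A) :=
    ((isClosed_localAlgebra c G).preimage (h.expect s).continuous).inter
      ((isClosed_localAlgebra c G).preimage
        ((h.expect s).continuous.comp (continuous_id.mul continuous_const)))
  refine localAlgebra_le hcl (fun t ht => ?_) hx
  rcases ht with rfl | ht
  · have := hmem _ (zero_mem _) _ (one_mem _)
    rwa [zero_add, one_mul] at this
  · have := hmem _ (mem_localAlgebra ht) _ (zero_mem _)
    rwa [zero_mul, add_zero] at this

end IsMajorana

/-! ### Trace, densities and grafting for finitely many generators. -/

theorem map_star_of_positive_on {A : Type*} [CStarAlgebra A] {S : StarSubalgebra ℂ A}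
    (hS : IsClosed (S : Set A)) (f : S →ₗ[ℂ] ℂ) (hf : ∀ x, 0 ≤ f (star x * x)) (x : S) :
    f (star x) = star (f x) :=
  let _ : CStarAlgebra S := StarSubalgebra.cstarAlgebra S (h_closed := hS)
  map_star_of_map_star_mul_self_nonneg f hf x

theorem continuous_of_positive_on {A : Type*} [CStarAlgebra A] {S : StarSubalgebra ℂ A}
    (hS : IsClosed (S : Set A)) (f : S →ₗ[ℂ] ℂ) (hf : ∀ x, 0 ≤ f (star x * x)) : Continuous f :=
  let _ : CStarAlgebra S := StarSubalgebra.cstarAlgebra S (h_closed := hS)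
  continuous_of_map_star_mul_self_nonneg f hf

/-- A self-adjoint element is a difference of squares with orthogonal roots. -/
theorem exists_orthogonal_roots {A : Type*} [CStarAlgebra A] {ρ : A} (hρ : IsSelfAdjoint ρ) :
    ∃ b g : A, star b = b ∧ star g = g ∧ b * b - g * g = ρ ∧ b * g = 0 ∧
      (∀ S : StarSubalgebra ℂ A, IsClosed (S : Set A) → ρ ∈ S → b ∈ S ∧ g ∈ S) ∧
      ∀ T : A →⋆ₐ[ℂ] A, T ρ = ρ → T b = b := by
  refine ⟨cfc (fun x : ℝ => √x) ρ, cfc (fun x : ℝ => √(-x)) ρ,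
    cfc_predicate (R := ℝ) _ ρ, cfc_predicate (R := ℝ) _ ρ, ?_, ?_, ?_, ?_⟩
  · rw [← cfc_mul (fun x : ℝ => √x) (fun x : ℝ => √x) ρ,
      ← cfc_mul (fun x : ℝ => √(-x)) (fun x : ℝ => √(-x)) ρ,
      ← cfc_sub (fun x : ℝ => √x * √x) (fun x : ℝ => √(-x) * √(-x)) ρ]
    conv_rhs => rw [← cfc_id' ℝ ρ]
    refine cfc_congr fun x _ => ?_
    rcases le_total 0 x with hx | hx
    · simp [Real.mul_self_sqrt hx, Real.sqrt_eq_zero_of_nonpos (neg_nonpos.mpr hx)]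
    · simp [Real.mul_self_sqrt (neg_nonneg.mpr hx), Real.sqrt_eq_zero_of_nonpos hx]
  · rw [← cfc_mul (fun x : ℝ => √x) (fun x : ℝ => √(-x)) ρ]
    conv_rhs => rw [← cfc_zero ℝ ρ]
    refine cfc_congr fun x _ => ?_
    rcases le_total 0 x with hx | hx
    · simp [Real.sqrt_eq_zero_of_nonpos (neg_nonpos.mpr hx)]
    · simp [Real.sqrt_eq_zero_of_nonpos hx]
  · intro S hS hρS
    have : IsClosed (S : Set A) := hS
    exact ⟨cfc_mem (S := StarSubalgebra ℂ A) (𝕜' := ℂ) _ hρS,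
      cfc_mem (S := StarSubalgebra ℂ A) (𝕜' := ℂ) _ hρS⟩
  · intro T hT
    have hc := continuous_starAlgHom T
    rw [T.map_cfc (fun x : ℝ => √x) ρ (by fun_prop) hc hρ (by rwa [hT]), hT]

namespace IsMajorana

variable {M A : Type*} [CStarAlgebra A] {c : M → A} {T : A →⋆ₐ[ℂ] A}

/-- The composition of the conditional expectations removing the generators in a list. -/
noncomputable def expectList (h : IsMajorana c T) : List M → A →L[ℂ] A
  | [] => ContinuousLinearMap.id ℂ A
  | s :: l => (h.expectList l).comp (h.expect s)

theorem expectList_cons (h : IsMajorana c T) (s : M) (l : List M) (x : A) :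
    h.expectList (s :: l) x = h.expectList l (h.expect s x) := rfl

/-- Each flip is a star-homomorphism, so one expectation turns `star x * x` into half a sum of two
elements of the same form. -/
theorem positive_expectList (h : IsMajorana c T) (l : List M) {ω : A →ₗ[ℂ] ℂ}
    (hω : ∀ x, 0 ≤ ω (star x * x)) (x : A) : 0 ≤ ω (h.expectList l (star x * x)) := by
  induction l generalizing x with
  | nil => exact hω x
  | cons s l ih =>
    rw [expectList_cons, expect_apply, map_mul, map_star, map_smul, map_smul, map_add, map_add]
    have h2 : (0 : ℂ) ≤ 2⁻¹ := by positivity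
    exact mul_nonneg h2 (add_nonneg (ih _) (ih _))

/-- `x` and its flip are both positive, so their sum vanishes only if both do. This is the source of
the faithfulness of the trace. -/
theorem expect_nonneg [PartialOrder A] [StarOrderedRing A] (h : IsMajorana c T) (s : M) {x : A}
    (hx : 0 ≤ x) : 0 ≤ h.expect s x ∧ (h.expect s x = 0 → x = 0) := by
  have h2 : (0 : ℂ) ≤ 2⁻¹ := by positivity
  have hf : 0 ≤ h.flip s x := map_nonneg _ hx
  rw [expect_apply]
  refine ⟨smul_nonneg h2 (add_nonneg hx hf), fun h0 => ?_⟩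
  have := (smul_eq_zero.mp h0).resolve_left (by norm_num)
  exact ((add_eq_zero_iff_of_nonneg hx hf).mp this).1

theorem eq_zero_of_expectList_eq_zero [PartialOrder A] [StarOrderedRing A] (h : IsMajorana c T)
    (l : List M) {x : A} (hx : 0 ≤ x) (h0 : h.expectList l x = 0) : x = 0 := by
  induction l generalizing x with
  | nil => exact h0
  | cons s l ih => exact (h.expect_nonneg s hx).2 (ih (h.expect_nonneg s hx).1 h0)

theorem eq_zero_of_expectList_star_mul_self (h : IsMajorana c T) (l : List M) {x : A}
    (h0 : h.expectList l (star x * x) = 0) : x = 0 := by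
  let _ := CStarAlgebra.spectralOrder A
  have _ := CStarAlgebra.spectralOrderedRing A
  exact CStarRing.star_mul_self_eq_zero_iff x |>.mp
    (h.eq_zero_of_expectList_eq_zero l (star_mul_self_nonneg x) h0)

theorem expectList_mul_mul (h : IsMajorana c T) (l : List M) {y z : A}
    (hy : ∀ s ∈ l, h.flip s y = y) (hz : ∀ s ∈ l, h.flip s z = z) (x : A) :
    h.expectList l (y * x * z) = y * h.expectList l x * z := by
  induction l generalizing x with
  | nil => rfl
  | cons s l ih =>
    rw [expectList_cons, h.expect_mul_mul (hy s (by simp)) (hz s (by simp)),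
      ih (fun t ht => hy t (by simp [ht])) (fun t ht => hz t (by simp [ht])), expectList_cons]

theorem expectList_flip (h : IsMajorana c T) (l : List M) {s : M} (hs : s ∈ l) (x : A) :
    h.expectList l (h.flip s x) = h.expectList l x := by
  induction l generalizing x with
  | nil => simp at hs
  | cons t l ih =>
    rw [expectList_cons, expectList_cons]
    rcases eq_or_ne s t with rfl | hst
    · rw [expect_flip_self]
    · rw [expect_flip, ih ((List.mem_cons.mp hs).resolve_left hst)]

theorem map_expectList (h : IsMajorana c T) (l : List M) (x : A) :
    T (h.expectList l x) = h.expectList l (T x) := by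
  induction l generalizing x with
  | nil => rfl
  | cons t l ih => rw [expectList_cons, expectList_cons, ih, map_expect]

theorem setOf_mem_cons (s : M) (l : List M) : {t | t ∈ s :: l} = insert s {t | t ∈ l} := by
  ext t
  simp

/-- Each expectation removes one generator, so after the whole list only the algebra of the empty
set is left. -/
theorem expectList_eq_algebraMap (h : IsMajorana c T) {l : List M} (hl : l.Nodup) {x : A}
    (hx : x ∈ localAlgebra c {t | t ∈ l}) : ∃ z : ℂ, h.expectList l x = algebraMap ℂ A z := by
  induction l generalizing x with
  | nil => exact exists_eq_algebraMap_of_mem_localAlgebra_empty (c := c) (x := x) (by simpa using hx)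
  | cons s l ih =>
    rw [setOf_mem_cons] at hx
    rw [List.nodup_cons] at hl
    exact ih hl.2 (h.expect_mem_and_expect_mul_gen_mem hl.1 hx).1

/-- By the expansion `u + v * c s`, a new generator at most doubles the dimension. -/
theorem finiteDimensional_localAlgebra (h : IsMajorana c T) {l : List M} (hl : l.Nodup) :
    FiniteDimensional ℂ (localAlgebra c {t | t ∈ l}).toSubalgebra.toSubmodule := by
  induction l with
  | nil =>
    refine Submodule.finiteDimensional_of_le (S₂ := LinearMap.range (Algebra.linearMap ℂ A)) ?_
    intro x hx
    obtain ⟨z, rfl⟩ := exists_eq_algebraMap_of_mem_localAlgebra_empty (c := c) (x := x)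
      (by simpa using hx)
    exact ⟨z, rfl⟩
  | cons s l ih =>
    rw [List.nodup_cons] at hl
    have := ih hl.2
    let V := (localAlgebra c {t | t ∈ l}).toSubalgebra.toSubmodule
    refine Submodule.finiteDimensional_of_le (S₂ := V ⊔ V.map (LinearMap.mulRight ℂ (c s))) ?_
    intro x hx
    rw [setOf_mem_cons] at hx
    obtain ⟨h1, h2⟩ := h.expect_mem_and_expect_mul_gen_mem hl.1 hx
    rw [← h.expect_add_expect_mul s x]
    exact Submodule.add_mem_sup h1 ⟨_, h2, rfl⟩

/-- The normalized trace of the algebra of finitely many generators. -/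
theorem exists_trace [Nontrivial A] (h : IsMajorana c T) {l : List M} (hl : l.Nodup) :
    ∃ τ : A →ₗ[ℂ] ℂ, (∀ x, 0 ≤ τ (star x * x)) ∧
      (∀ x ∈ localAlgebra c {t | t ∈ l}, h.expectList l x = algebraMap ℂ A (τ x)) ∧
      (∀ x ∈ localAlgebra c {t | t ∈ l}, τ (T x) = τ x) ∧
      (∀ x ∈ localAlgebra c {t | t ∈ l}, ∀ y ∈ localAlgebra c {t | t ∈ l},
        τ (x * y) = τ (y * x)) ∧
      (∀ x ∈ localAlgebra c {t | t ∈ l}, τ (star x * x) = 0 → x = 0) := by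
  -- The choice of `ω` does not matter on the local algebra: there the iterated expectation is
  -- already scalar and `ω` only reads the scalar off.
  obtain ⟨ω, hω, hω1⟩ := exists_unital_positive_functional (B := A)
  let τ : A →ₗ[ℂ] ℂ := ω.comp (h.expectList l : A →ₗ[ℂ] A)
  have hτ : ∀ x, 0 ≤ τ (star x * x) := h.positive_expectList l hω
  have hE : ∀ x ∈ localAlgebra c {t | t ∈ l}, h.expectList l x = algebraMap ℂ A (τ x) := by
    intro x hx
    obtain ⟨z, hz⟩ := h.expectList_eq_algebraMap hl hx
    have : τ x = z := by
      show ω (h.expectList l x) = z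
      rw [hz, Algebra.algebraMap_eq_smul_one, map_smul, hω1, smul_eq_mul, mul_one]
    rw [this, hz]
  have hT : ∀ x ∈ localAlgebra c {t | t ∈ l}, τ (T x) = τ x := by
    intro x hx
    apply (algebraMap ℂ A).injective
    rw [← hE _ (h.map_mem hx), ← map_expectList, hE x hx]
    exact AlgHomClass.commutes T _
  -- `c s * x` is the flip at `s` of `T (x * c s)`, and `τ` is invariant under both maps.
  have hconj : ∀ s ∈ l, ∀ x ∈ localAlgebra c {t | t ∈ l}, τ (c s * x) = τ (x * c s) := by
    intro s hs x hx
    have hcs : c s ∈ localAlgebra c {t | t ∈ l} := mem_localAlgebra hs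
    rw [← hT _ (mul_mem hx hcs)]
    show _ = ω (h.expectList l (T (x * c s)))
    rw [← h.expectList_flip l hs, flip_apply, h.map_map, mul_assoc, h.mul_mul_self]
    rfl
  have hcont : Continuous τ := continuous_of_map_star_mul_self_nonneg τ hτ
  have hstar : ∀ x, τ (star x) = star (τ x) := map_star_of_map_star_mul_self_nonneg τ hτ
  refine ⟨τ, hτ, hE, hT, fun x hx y hy => ?_, fun x hx h0 => ?_⟩
  · let D := localAlgebra c {t | t ∈ l}
    let W : StarSubalgebra ℂ A :=
      { carrier := {x | x ∈ D ∧ ∀ y ∈ D, τ (x * y) = τ (y * x)}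
        mul_mem' := by
          rintro u v ⟨hu, hu'⟩ ⟨hv, hv'⟩
          refine ⟨mul_mem hu hv, fun y hy => ?_⟩
          rw [mul_assoc, hu' _ (mul_mem hv hy), mul_assoc, hv' _ (mul_mem hy hu), mul_assoc]
        add_mem' := by
          rintro u v ⟨hu, hu'⟩ ⟨hv, hv'⟩
          refine ⟨add_mem hu hv, fun y hy => ?_⟩
          rw [add_mul, mul_add, map_add, map_add, hu' y hy, hv' y hy]
        algebraMap_mem' := fun r => ⟨algebraMap_mem D r, fun y _ => by
          rw [Algebra.commutes]⟩
        star_mem' := by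
          rintro u ⟨hu, hu'⟩
          refine ⟨star_mem hu, fun y hy => ?_⟩
          have := congrArg star (hu' (star y) (star_mem hy))
          rw [← hstar, ← hstar, star_mul, star_mul, star_star] at this
          exact this.symm }
    have hcl : IsClosed (W : Set A) := by
      have : (W : Set A) = (D : Set A) ∩ ⋂ y ∈ D, {x | τ (x * y) = τ (y * x)} := by
        ext x
        simp only [Set.mem_inter_iff, Set.mem_iInter]
        rfl
      rw [this]
      exact (isClosed_localAlgebra c _).inter (isClosed_biInter fun y _ =>
        isClosed_eq (hcont.comp (continuous_id.mul continuous_const))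
          (hcont.comp (continuous_const.mul continuous_id)))
    exact (localAlgebra_le hcl (fun s hs => ⟨mem_localAlgebra hs, hconj s hs⟩) hx).2 y hy
  · refine h.eq_zero_of_expectList_star_mul_self l ?_
    rw [hE _ (mul_mem (star_mem hx) hx), h0, map_zero]

/-- A positive functional on the algebra of finitely many generators has a density, given here by
its square root. -/
theorem exists_sqrt_density [Nontrivial A] (h : IsMajorana c T) {l : List M} (hl : l.Nodup)
    (f : localAlgebra c {t | t ∈ l} →ₗ[ℂ] ℂ) (hf : ∀ x, 0 ≤ f (star x * x)) :
    ∃ b ∈ localAlgebra c {t | t ∈ l}, star b = b ∧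
      (∀ z : localAlgebra c {t | t ∈ l}, h.expectList l (b * z * b) = algebraMap ℂ A (f z)) ∧
      ((∀ z : localAlgebra c {t | t ∈ l}, f ⟨T z, h.map_mem z.2⟩ = f z) → T b = b) := by
  obtain ⟨τ, hτ, hE, hT, htr, hfaith⟩ := h.exists_trace hl
  have hcl : IsClosed (localAlgebra c {t | t ∈ l} : Set A) := isClosed_localAlgebra c _
  have _ : FiniteDimensional ℂ (localAlgebra c {t | t ∈ l}) := h.finiteDimensional_localAlgebra hl
  let L : localAlgebra c {t | t ∈ l} →ₗ[ℂ] localAlgebra c {t | t ∈ l} →ₗ[ℂ] ℂ := LinearMap.mk₂ ℂ (fun x z => τ (x * z))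
    (fun x y z => by simp [add_mul]) (fun r x z => by simp)
    (fun x y z => by simp [mul_add]) (fun r x z => by simp)
  -- Faithfulness makes the trace form nondegenerate; in finite dimension every functional is then
  -- `τ (ρ * ·)` for a unique `ρ`.
  have hLi : Function.Injective L := by
    rw [injective_iff_map_eq_zero]
    intro x hx
    have h1 : τ (x * star (x : A)) = 0 := LinearMap.congr_fun hx (star x)
    have h2 := hfaith (star (x : A)) (star_mem x.2) (by rwa [star_star])
    exact Subtype.ext (star_eq_zero.mp h2)
  obtain ⟨ρ, hρ⟩ : ∃ ρ, L ρ = f :=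
    ((LinearMap.injective_iff_surjective_of_finrank_eq_finrank
      (Subspace.dual_finrank_eq (K := ℂ) (V := localAlgebra c {t | t ∈ l})).symm).mp hLi) f
  have hρ' : ∀ z : localAlgebra c {t | t ∈ l}, τ (ρ * z) = f z := fun z => LinearMap.congr_fun hρ z
  have hsa : star ρ = ρ := by
    refine hLi (LinearMap.ext fun z => ?_)
    show τ (star (ρ : A) * z) = τ (ρ * z)
    have h1 := hρ' (star z)
    rw [map_star_of_positive_on hcl f hf] at h1
    rw [hρ' z, ← star_star (f z), ← h1, ← map_star_of_map_star_mul_self_nonneg τ hτ, star_mul]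
    show _ = τ (star (star (z : A)) * _)
    rw [star_star, htr _ (star_mem ρ.2) _ z.2]
  obtain ⟨b, g, hb, hg, hbg, hbg0, hS, hT'⟩ :=
    exists_orthogonal_roots (ρ := (ρ : A)) (congrArg Subtype.val hsa)
  obtain ⟨hbD, hgD⟩ := hS _ hcl ρ.2
  -- Testing `f` on `g * g`, the negative part of `ρ`, gives `f (g²) = -τ (g⁴) ≥ 0`, so `g² = 0` by
  -- faithfulness and `ρ = b²`.
  have hgg : g * g = 0 := by
    refine hfaith _ (mul_mem hgD hgD) (le_antisymm ?_ (hτ _))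
    have h1 := hf ⟨g, hgD⟩
    rw [← hρ'] at h1
    have h2 : (ρ : A) * (star g * g) = -(star (g * g) * (g * g)) := by
      rw [star_mul, hg, ← hbg, sub_mul, mul_assoc b b, ← mul_assoc b g g, hbg0]
      simp
    have h3 : 0 ≤ τ ((ρ : A) * (star g * g)) := h1
    rw [h2, map_neg] at h3
    exact neg_nonneg.mp h3
  have hbb : b * b = ρ := by rw [← hbg, hgg, sub_zero]
  refine ⟨b, hbD, hb, fun z => ?_, fun hev => hT' T ?_⟩
  · rw [hE _ (mul_mem (mul_mem hbD z.2) hbD), htr _ (mul_mem hbD z.2) _ hbD, ← mul_assoc, hbb, hρ']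
  -- If `f` is invariant, `T ρ` represents `f` too, and the density is unique.
  · have : (⟨T ρ, h.map_mem ρ.2⟩ : localAlgebra c {t | t ∈ l}) = ρ := by
      refine hLi (LinearMap.ext fun z => ?_)
      show τ (T ρ * z) = τ (ρ * z)
      rw [hρ', ← hev, ← hρ', ← hT _ (mul_mem (h.map_mem ρ.2) z.2), map_mul, h.map_map]
    exact congrArg Subtype.val this

/-- A state of the algebra of finitely many generators can be grafted onto a given state. If it is
even, the result is a product state with respect to the remaining generators. -/
theorem exists_graft [Nontrivial A] (h : IsMajorana c T) {J : Set M} (hJ : J.Finite)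
    (f : localAlgebra c J →ₗ[ℂ] ℂ) (hf : ∀ x, 0 ≤ f (star x * x)) (hf1 : f 1 = 1)
    (ω : A →ₗ[ℂ] ℂ) (hω : ∀ x, 0 ≤ ω (star x * x)) (hω1 : ω 1 = 1) :
    ∃ ω' : A →ₗ[ℂ] ℂ, (∀ x, 0 ≤ ω' (star x * x)) ∧ ω' 1 = 1 ∧
      (∀ z : localAlgebra c J, ω' z = f z) ∧
      ((∀ z : localAlgebra c J, f ⟨T z, h.map_mem z.2⟩ = f z) → ∀ K : Set M, Disjoint J K →
        ∀ y ∈ localAlgebra c K, ∀ y' ∈ localAlgebra c K, ∀ z : localAlgebra c J,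
          ω' (y * z * y') = ω (y * y') * f z) := by
  obtain ⟨l, hl, rfl⟩ : ∃ l : List M, l.Nodup ∧ {t | t ∈ l} = J :=
    ⟨hJ.toFinset.toList, Finset.nodup_toList _, by ext; simp⟩
  obtain ⟨b, hbD, hb, hbf, hbT⟩ := h.exists_sqrt_density hl f hf
  -- Placing `b` on both sides, rather than `b²` on one, makes the functional positive on all of
  -- `A`, since `b * (star x * x) * b = star (x * b) * (x * b)`.
  let ω' : A →ₗ[ℂ] ℂ := ω.comp ((h.expectList l : A →ₗ[ℂ] A).comp
    ((LinearMap.mulRight ℂ b).comp (LinearMap.mulLeft ℂ b)))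
  have happ : ∀ x, ω' x = ω (h.expectList l (b * x * b)) := fun x => rfl
  have hz : ∀ z : localAlgebra c {t | t ∈ l}, ω' z = f z := fun z => by
    rw [happ, hbf, Algebra.algebraMap_eq_smul_one, map_smul, hω1, smul_eq_mul, mul_one]
  refine ⟨ω', fun x => ?_, (hz 1).trans hf1, hz, fun hev K hK y hy y' hy' z => ?_⟩
  · have : b * (star x * x) * b = star (x * b) * (x * b) := by
      rw [star_mul, hb]
      simp only [mul_assoc]
    rw [happ, this]
    exact h.positive_expectList l hω _
  · have hfix : ∀ y ∈ localAlgebra c K, ∀ s ∈ l, h.flip s y = y := fun y hy s hs =>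
      h.flip_eq_self (fun hsK => hK.le_bot ⟨hs, hsK⟩) hy
    have e1 := h.commute_of_map_eq hK hbD (hbT hev) hy
    have e2 := h.commute_of_map_eq hK hbD (hbT hev) hy'
    have e3 : b * (y * z * y') * b = y * (b * z * b) * y' := by
      calc b * (y * z * y') * b = (b * y) * z * (y' * b) := by simp only [mul_assoc]
        _ = y * (b * z * b) * y' := by
          rw [e1, ← e2]
          simp only [mul_assoc]
    rw [happ, e3, h.expectList_mul_mul l (hfix y hy) (hfix y' hy'), hbf,
      Algebra.algebraMap_eq_smul_one, mul_smul_comm, mul_one, smul_mul_assoc, map_smul,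
      smul_eq_mul, mul_comm]

end IsMajorana

/-! ### From Fermion operators to Majorana generators; product states on finite regions. -/

/-- The self-adjoint combinations of the annihilation and creation operators. -/
noncomputable def majorana {Λ A : Type*} [CStarAlgebra A] (a : Λ → A) (p : Λ × Bool) : A :=
  if p.2 then a p.1 + star (a p.1) else Complex.I • (a p.1 - star (a p.1))

theorem localAlgebra_majorana {Λ A : Type*} [CStarAlgebra A] (a : Λ → A) (K : Set Λ) :
    localAlgebra (majorana a) (Prod.fst ⁻¹' K) = localAlgebra a K := by
  apply le_antisymm
  · refine localAlgebra_le (isClosed_localAlgebra a K) ?_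
    rintro ⟨i, b⟩ hi
    have h1 : a i ∈ localAlgebra a K := mem_localAlgebra hi
    cases b
    · exact (localAlgebra a K).smul_mem (sub_mem h1 (star_mem h1)) Complex.I
    · exact add_mem h1 (star_mem h1)
  · refine localAlgebra_le (isClosed_localAlgebra _ _) fun i hi => ?_
    have h1 : majorana a (i, true) ∈ localAlgebra (majorana a) (Prod.fst ⁻¹' K) :=
      mem_localAlgebra hi
    have h2 : majorana a (i, false) ∈ localAlgebra (majorana a) (Prod.fst ⁻¹' K) :=
      mem_localAlgebra hi
    have h3 : a i = (2 : ℂ)⁻¹ • (majorana a (i, true) + (-Complex.I) • majorana a (i, false)) := by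
      simp only [majorana, if_true, Bool.false_eq_true, if_false, smul_smul, neg_mul,
        Complex.I_mul_I, neg_neg, one_smul]
      module
    rw [h3]
    exact StarSubalgebra.smul_mem _ (add_mem h1 (StarSubalgebra.smul_mem _ h2 _)) _

theorem list_prod_mem_localAlgebra {Λ A ι : Type*} [CStarAlgebra A] {a : Λ → A} (I : ι → Set Λ)
    (x : ∀ i, localAlgebra a (I i))
    (l : List ι) {K : Set Λ} (h : ∀ i ∈ l, I i ⊆ K) :
    (l.map fun i => (x i : A)).prod ∈ localAlgebra a K := by
  refine list_prod_mem fun y hy => ?_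
  obtain ⟨i, hi, rfl⟩ := List.mem_map.mp hy
  exact localAlgebra_mono a (h i hi) (x i).2

theorem State.exists_restrict {A : Type*} [CStarAlgebra A] {R S : StarSubalgebra ℂ A} (hle :
    S ≤ R) (φ : State R) :
    ∃ f : S →ₗ[ℂ] ℂ, (∀ x, 0 ≤ f (star x * x)) ∧ f 1 = 1 ∧
      ∀ (x : A) (hx : x ∈ S), f ⟨x, hx⟩ = φ.toFun ⟨x, hle hx⟩ := by
  refine ⟨φ.toFun.comp (StarSubalgebra.inclusion hle).toAlgHom.toLinearMap, fun x => ?_, ?_,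
    fun x hx => rfl⟩
  · have : φ.toFun (StarSubalgebra.inclusion hle (star x * x)) =
        φ.toFun (star (StarSubalgebra.inclusion hle x) * StarSubalgebra.inclusion hle x) := by
      rw [map_mul, map_star]
    exact (φ.nonneg _).trans_eq this.symm
  · have : φ.toFun (StarSubalgebra.inclusion hle 1) = φ.toFun 1 := by rw [_root_.map_one]
    exact this.trans φ.map_one

theorem State.exists_of_functional {A : Type*} [CStarAlgebra A] (S : StarSubalgebra ℂ A) (L :
    A →ₗ[ℂ] ℂ)
    (hL : ∀ x, 0 ≤ L (star x * x)) (hL1 : L 1 = 1) : ∃ φ : State S, ∀ x, φ.toFun x = L x :=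
  ⟨⟨L.comp S.toSubalgebra.toSubmodule.subtype, fun x => hL x, hL1⟩, fun _ => rfl⟩

section Fermion

variable {Λ A : Type*} [DecidableEq Λ] [CStarAlgebra A] {a : Λ → A}

theorem IsFermionAlgebra.parity_parity (ha : IsFermionAlgebra a) (x : A) :
    parity ha (parity ha x) = x := by
  have h := ha.starAlgHom_ext
    (S := (StarAlgEquiv.toStarAlgHom (parity ha)).comp (StarAlgEquiv.toStarAlgHom (parity ha)))
    (T := StarAlgHom.id ℂ A) (fun i => by simp [parity_apply])
  exact congrArg (fun U : A →⋆ₐ[ℂ] A => U x) h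

theorem IsFermionAlgebra.isMajorana (ha : IsFermionAlgebra a) :
    IsMajorana (majorana a) (StarAlgEquiv.toStarAlgHom (parity ha)) where
  star_eq := by
    rintro ⟨i, b⟩
    cases b
    · simp only [majorana, Bool.false_eq_true, if_false, star_smul, star_sub, star_star,
        Complex.star_def, Complex.conj_I]
      module
    · simp [majorana, add_comm]
  mul_self := by
    rintro ⟨i, b⟩
    have h1 : a i * star (a i) = 1 - star (a i) * a i := by
      rw [eq_sub_iff_add_eq']
      simpa using ha.star_anticomm i i
    have h2 : a i * a i = 0 := by
      have h := ha.anticomm i i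
      rw [← two_smul ℂ] at h
      exact (smul_eq_zero.mp h).resolve_left two_ne_zero
    have h3 : star (a i) * star (a i) = 0 := by rw [← star_mul, h2, star_zero]
    cases b
    · simp only [majorana, Bool.false_eq_true, if_false]
      rw [smul_mul_smul_comm, Complex.I_mul_I]
      simp only [mul_sub, sub_mul, h1, h2, h3]
      module
    · simp only [majorana, if_true, mul_add, add_mul, h1, h2, h3]
      module
  anticomm := by
    rintro ⟨i, b⟩ ⟨j, b'⟩ hne
    have h1 : star (a i) * a j = (if i = j then 1 else 0) - a j * star (a i) :=
      eq_sub_of_add_eq (ha.star_anticomm i j)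
    have h2 : a i * star (a j) = (if i = j then 1 else 0) - star (a j) * a i := by
      rw [eq_sub_iff_add_eq', ha.star_anticomm j i]
      simp only [eq_comm]
    have h3 : a i * a j = -(a j * a i) := eq_neg_of_add_eq_zero_left (ha.anticomm i j)
    have h4 : star (a i) * star (a j) = -(star (a j) * star (a i)) :=
      eq_neg_of_add_eq_zero_left (ha.star_anticomm_star i j)
    cases b <;> cases b' <;>
    simp only [majorana, Bool.false_eq_true, if_false, if_true, smul_mul_assoc, mul_smul_comm,
      mul_sub, sub_mul, mul_add, add_mul, h1, h2, h3, h4]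
    · have hij : i ≠ j := fun e => hne (by rw [e])
      simp only [hij, if_false]
      module
    · module
    · module
    · have hij : i ≠ j := fun e => hne (by rw [e])
      simp only [hij, if_false]
      module
  map_eq := by
    rintro ⟨i, b⟩
    have h1 : StarAlgEquiv.toStarAlgHom (parity ha) (a i) = -a i := parity_apply ha i
    cases b
    · simp only [majorana, Bool.false_eq_true, if_false, map_smul, map_sub, map_star, h1, star_neg]
      module
    · simp only [majorana, if_true, map_add, map_star, h1, star_neg]
      module
  map_map := ha.parity_parity

/-- The states of an algebra of finitely many sites can be grafted onto a given state. -/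
theorem IsFermionAlgebra.exists_graft [Nontrivial A] (ha : IsFermionAlgebra a) {K : Set Λ}
    (φ : State (localAlgebra a K)) (F : Finset Λ)
    (ω : A →ₗ[ℂ] ℂ) (hω : ∀ x, 0 ≤ ω (star x * x)) (hω1 : ω 1 = 1) :
    ∃ ω' : A →ₗ[ℂ] ℂ, (∀ x, 0 ≤ ω' (star x * x)) ∧ ω' 1 = 1 ∧
      (∀ z : localAlgebra a K, (z : A) ∈ localAlgebra a (K ∩ F) → ω' z = φ.toFun z) ∧
      (φ.IsEven ha → ∀ K' : Set Λ, Disjoint K K' →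
        ∀ y ∈ localAlgebra a K', ∀ y' ∈ localAlgebra a K', ∀ z : localAlgebra a K,
          (z : A) ∈ localAlgebra a (K ∩ F) → ω' (y * z * y') = ω (y * y') * φ.toFun z) := by
  have hle : localAlgebra (majorana a) (Prod.fst ⁻¹' (K ∩ F)) ≤ localAlgebra a K := by
    rw [localAlgebra_majorana]
    exact localAlgebra_mono a Set.inter_subset_left
  have hfin : (Prod.fst ⁻¹' (K ∩ F) : Set (Λ × Bool)).Finite := by
    refine ((F ×ˢ (Finset.univ : Finset Bool)).finite_toSet).subset ?_
    rintro ⟨i, b⟩ hi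
    simpa using hi.2
  obtain ⟨f, hf, hf1, hφ⟩ := φ.exists_restrict hle
  obtain ⟨ω', h1, h2, h3, h4⟩ := ha.isMajorana.exists_graft hfin f hf hf1 ω hω hω1
  refine ⟨ω', h1, h2, fun z hz => ?_, fun hev K' hK y hy y' hy' z hz => ?_⟩
  · rw [← localAlgebra_majorana] at hz
    exact (h3 ⟨z, hz⟩).trans (hφ z hz)
  · rw [← localAlgebra_majorana] at hz hy hy'
    have hfev : ∀ w : localAlgebra (majorana a) (Prod.fst ⁻¹' (K ∩ F)),
        f ⟨_, ha.isMajorana.map_mem w.2⟩ = f w := fun w =>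
      (hφ _ _).trans ((hev ⟨w, hle w.2⟩).trans (hφ w w.2).symm)
    exact (h4 hfev _ ((hK.mono_left Set.inter_subset_left).preimage Prod.fst) y hy y' hy'
      ⟨z, hz⟩).trans (congrArg _ (hφ z hz))

/-- The product state on the algebra of finitely many sites. -/
theorem IsFermionAlgebra.exists_finite_product (ha : IsFermionAlgebra a) {ι : Type*}
    (I : ι → Set Λ) (hI : Pairwise fun i j => Disjoint (I i) (I j))
    (φs : ∀ i, State (localAlgebra a (I i)))
    (hev : ∀ i j, ¬ (φs i).IsEven ha → ¬ (φs j).IsEven ha → i = j) (F : Finset Λ) (s : Finset ι) :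
    ∃ ω : A →ₗ[ℂ] ℂ, (∀ x, 0 ≤ ω (star x * x)) ∧ ω 1 = 1 ∧
      ∀ l : List ι, l.Nodup → (∀ i ∈ l, i ∈ s ∨ ¬ (φs i).IsEven ha) →
        ∀ x : ∀ i, localAlgebra a (I i), (∀ i ∈ l, (x i : A) ∈ localAlgebra a (I i ∩ F)) →
          ω (l.map fun i => (x i : A)).prod = (l.map fun i => (φs i).toFun (x i)).prod := by
  classical
  have hnt : Nontrivial A := ⟨⟨1, 0, ha.one_ne_zero⟩⟩
  induction s using Finset.induction_on with
  | empty =>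
    obtain ⟨ω₀, hω₀, hω₀1⟩ := exists_unital_positive_functional (B := A)
    -- The exceptional state enters at the start, where grafting has only to extend it. With `s`
    -- empty the admissible lists contain at most this one index.
    by_cases hex : ∃ i, ¬ (φs i).IsEven ha
    · obtain ⟨i, hi⟩ := hex
      obtain ⟨ω, h1, h2, h3, -⟩ := ha.exists_graft (φs i) F ω₀ hω₀ hω₀1
      refine ⟨ω, h1, h2, fun l hl hls x hx => ?_⟩
      have hsub : ∀ j ∈ l, j = i := fun j hj => hev j i (by simpa using hls j hj) hi
      match l, hl with
      | [], _ => simpa using h2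
      | [j], _ =>
        obtain rfl := hsub j (by simp)
        simpa using h3 (x j) (hx j (by simp))
      | j :: k :: l, hl =>
        have e1 := hsub j (by simp)
        have e2 := hsub k (by simp)
        simp [e1, e2] at hl
    · refine ⟨ω₀, hω₀, hω₀1, fun l _ hls x _ => ?_⟩
      have : l = [] := List.eq_nil_iff_forall_not_mem.mpr fun j hj =>
        hex ⟨j, by simpa using hls j hj⟩
      subst this
      simpa using hω₀1
  | insert i s _ ih =>
    obtain ⟨ω, hω, hω1, hprod⟩ := ih
    by_cases hi : (φs i).IsEven ha
    swap
    -- A non-even index is already admitted by the induction hypothesis, so nothing is grafted.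
    · refine ⟨ω, hω, hω1, fun l hl hls x hx => hprod l hl (fun j hj => ?_) x hx⟩
      rcases hls j hj with h | h
      · rcases Finset.mem_insert.mp h with rfl | h
        · exact Or.inr hi
        · exact Or.inl h
      · exact Or.inr h
    obtain ⟨ω', h1, h2, -, h4⟩ := ha.exists_graft (φs i) F ω hω hω1
    refine ⟨ω', h1, h2, fun l hl hls x hx => ?_⟩
    have hdisj : Disjoint (I i) (⋃ j ∈ {j | j ≠ i}, I j) := by
      simp only [Set.disjoint_iUnion_right]
      exact fun j hj => hI (Ne.symm hj)
    have hmem : ∀ l' : List ι, i ∉ l' →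
        (l'.map fun j => (x j : A)).prod ∈ localAlgebra a (⋃ j ∈ {j | j ≠ i}, I j) := fun l' h =>
      list_prod_mem_localAlgebra I x l' fun j hj =>
        Set.subset_biUnion_of_mem (u := I) (show j ∈ {j | j ≠ i} from fun e => h (e ▸ hj))
    have hls' : ∀ j ∈ l, j ≠ i → j ∈ s ∨ ¬ (φs j).IsEven ha := fun j hj hne => by
      rcases hls j hj with h | h
      · exact Or.inl ((Finset.mem_insert.mp h).resolve_left hne)
      · exact Or.inr h
    by_cases hil : i ∈ l
    -- The factor of index `i` may stand anywhere in the product; the two-sided graft identity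
    -- extracts it from between the other factors.
    · obtain ⟨l₁, l₂, rfl⟩ := List.append_of_mem hil
      have hnd := (List.nodup_middle.mp hl)
      rw [List.nodup_cons, List.mem_append, not_or] at hnd
      have h5 := h4 hi _ hdisj _ (hmem l₁ hnd.1.1) _ (hmem l₂ hnd.1.2) (x i) (hx i hil)
      have h6 := hprod (l₁ ++ l₂) hnd.2
        (fun j hj => hls' j (by simp at hj ⊢; tauto) (by
          rintro rfl
          simp at hj
          tauto))
        x (fun j hj => hx j (by simp at hj ⊢; tauto))
      rw [List.map_append, List.prod_append, List.map_append, List.prod_append] at h6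
      rw [List.map_append, List.prod_append, List.map_cons, List.prod_cons, ← mul_assoc, h5, h6,
        List.map_append, List.prod_append, List.map_cons, List.prod_cons]
      ring
    -- Taking `z = 1` and `y' = 1` shows that the graft leaves products without index `i` unchanged.
    · have h5 := h4 hi _ hdisj _ (hmem l hil) 1 (one_mem _) 1 (one_mem _)
      have h6 : (φs i).toFun 1 = 1 := (φs i).map_one
      have h7 : (((1 : localAlgebra a (I i)) : A)) = 1 := rfl
      rw [h6, h7, mul_one, mul_one, mul_one] at h5
      rw [h5]
      exact hprod l hl (fun j hj => hls' j hj fun e => hil (e ▸ hj)) x hx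

end Fermion

/-! ### Finitely localized elements and limits of states. -/

section Density

variable {Λ A : Type*} [CStarAlgebra A]

theorem dense_localAlgebra (a : Λ → A) (K : Set Λ) {s : Set A}
    (hs : (StarAlgebra.adjoin ℂ (a '' K) : Set A) ⊆ s) :
    Dense {x : localAlgebra a K | (x : A) ∈ s} := by
  intro x
  rw [Topology.IsInducing.subtypeVal.closure_eq_preimage_closure_image]
  have hx : (x : A) ∈ closure (StarAlgebra.adjoin ℂ (a '' K) : Set A) := x.2
  refine closure_mono (fun y hy => ?_) hx
  exact ⟨⟨y, StarSubalgebra.le_topologicalClosure _ hy⟩, hs hy, rfl⟩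

theorem exists_finset_of_mem_adjoin {a : Λ → A} {K : Set Λ} {y : A}
    (hy : y ∈ StarAlgebra.adjoin ℂ (a '' K)) : ∃ F : Finset Λ, y ∈ localAlgebra a (K ∩ F) := by
  classical
  have hmono : ∀ {F G : Finset Λ} {z : A}, F ⊆ G → z ∈ localAlgebra a (K ∩ F) →
      z ∈ localAlgebra a (K ∩ G) := fun hFG hz =>
    localAlgebra_mono a (Set.inter_subset_inter_right _ (Finset.coe_subset.mpr hFG)) hz
  induction hy using StarAlgebra.adjoin_induction with
  | mem x hx =>
    obtain ⟨i, hi, rfl⟩ := hx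
    exact ⟨{i}, mem_localAlgebra ⟨hi, by simp⟩⟩
  | algebraMap r => exact ⟨∅, algebraMap_mem _ r⟩
  | add x y _ _ hx hy =>
    obtain ⟨F, hF⟩ := hx
    obtain ⟨G, hG⟩ := hy
    exact ⟨F ∪ G, add_mem (hmono Finset.subset_union_left hF) (hmono Finset.subset_union_right hG)⟩
  | mul x y _ _ hx hy =>
    obtain ⟨F, hF⟩ := hx
    obtain ⟨G, hG⟩ := hy
    exact ⟨F ∪ G, mul_mem (hmono Finset.subset_union_left hF) (hmono Finset.subset_union_right hG)⟩
  | star x _ hx =>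
    obtain ⟨F, hF⟩ := hx
    exact ⟨F, star_mem hF⟩

/-- The limit of a family of states along an ultrafilter. -/
theorem exists_limit_state {P : Type*} (U : Ultrafilter P) (ω : P → A →ₗ[ℂ] ℂ)
    (hω : ∀ p x, 0 ≤ ω p (star x * x)) (hω1 : ∀ p, ω p 1 = 1) :
    ∃ L : A →ₗ[ℂ] ℂ, (∀ x, 0 ≤ L (star x * x)) ∧ L 1 = 1 ∧
      ∀ x z, (∀ᶠ p in U, ω p x = z) → L x = z := by
  have hex : ∀ x, ∃ y, Filter.Tendsto (fun p => ω p x) U (𝓝 y) := fun x => by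
    -- Since every `ω p` is unital, one compact ball contains all the values at `x`.
    obtain ⟨y, -, hy⟩ := (isCompact_closedBall (0 : ℂ) (4 * ‖x‖)).ultrafilter_le_nhds
      (U.map fun p => ω p x) (by
        rw [Filter.le_principal_iff]
        refine Filter.mem_map.mpr (Filter.Eventually.of_forall fun p => ?_)
        have := norm_apply_le_of_map_star_mul_self_nonneg (ω p) (hω p) x
        rw [hω1, norm_one, mul_one] at this
        simpa using this)
    exact ⟨y, hy⟩
  choose L hL using hex
  refine ⟨{ toFun := L
            map_add' := fun x y => tendsto_nhds_unique (hL _)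
              (by simpa only [map_add] using (hL x).add (hL y))
            map_smul' := fun r x => tendsto_nhds_unique (hL _)
              (by simpa only [map_smul] using! (hL x).const_smul r) }, fun x => ?_, ?_, ?_⟩
  · exact ge_of_tendsto (hL (star x * x)) (Filter.Eventually.of_forall fun p => hω p x)
  · exact tendsto_nhds_unique (hL 1) (by simpa only [hω1] using tendsto_const_nhds)
  · intro x z hz
    exact tendsto_nhds_unique (hL x) (tendsto_const_nhds.congr' (hz.mono fun _ h => h.symm))

end Density

/-! ### The product property over lists of indices, and existence on arbitrary regions. -/

theorem exists_dependent_extension {κ ι : Type*} {β : ι → Type*} [∀ i, Nonempty (β i)] {k : κ → ι}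
    (hk : Function.Injective k) (x : ∀ j, β (k j)) : ∃ x' : ∀ i, β i, ∀ j, x' (k j) = x j := by
  have : ∀ i, ∃ y : β i, ∀ j, ∀ e : k j = i, y = e ▸ x j := fun i => by
    by_cases h : ∃ j, k j = i
    · obtain ⟨j, rfl⟩ := h
      refine ⟨x j, fun j' e => ?_⟩
      obtain rfl := hk e
      rfl
    · exact ⟨Classical.arbitrary _, fun j e => (h ⟨j, e⟩).elim⟩
  choose x' hx' using this
  exact ⟨x', fun j => hx' _ j rfl⟩

theorem coe_starSubalgebra_inclusion {A : Type*} [CStarAlgebra A] {R S : StarSubalgebra ℂ A}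
    (h : S ≤ R) (x : S) : (StarSubalgebra.inclusion h x : A) = x := rfl

theorem coe_prod_map_inclusion {Λ A ι : Type*} [CStarAlgebra A] (a : Λ → A) (I : ι → Set Λ)
    (l : List ι) (x : ∀ i, localAlgebra a (I i)) :
    ((l.map fun i => StarSubalgebra.inclusion (localAlgebra_mono a (Set.subset_iUnion I i))
      (x i)).prod : localAlgebra a (⋃ i, I i)) = (l.map fun i => (x i : A)).prod := by
  induction l with
  | nil => exact OneMemClass.coe_one (localAlgebra a (⋃ i, I i))
  | cons i l ih =>
    rw [List.map_cons, List.map_cons, List.prod_cons, List.prod_cons, MulMemClass.coe_mul, ih,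
      coe_starSubalgebra_inclusion]

theorem ofFn_get_eq_map {ι γ : Type*} (l : List ι) (f : ι → γ) :
    (List.ofFn fun j => f (l.get j)) = l.map f := by
  rw [← Function.comp_def, ← List.map_ofFn, List.ofFn_get]

/-- Duplicate-free lists together with one family over all of `ι` suit induction on the list and
continuity in the family. As `k` is injective, factors given along `k` extend to such a family. -/
theorem isProductExtension_iff {Λ A ι : Type*} [CStarAlgebra A] (a : Λ → A) (I : ι → Set Λ)
    (φs : ∀ i, State (localAlgebra a (I i))) (φ : State (localAlgebra a (⋃ i, I i))) :
    IsProductExtension a I φs φ ↔ ∀ l : List ι, l.Nodup → ∀ x : ∀ i, localAlgebra a (I i),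
      φ.toFun (l.map fun i => StarSubalgebra.inclusion
        (localAlgebra_mono a (Set.subset_iUnion I i)) (x i)).prod
      = (l.map fun i => (φs i).toFun (x i)).prod := by
  constructor
  · intro h l hl x
    have := h l.length l.get (List.nodup_iff_injective_get.mp hl) (fun j => x (l.get j))
    rw [← List.prod_ofFn] at this
    have e1 := ofFn_get_eq_map l fun i => StarSubalgebra.inclusion
        (localAlgebra_mono a (Set.subset_iUnion I i)) (x i)
    have e2 := ofFn_get_eq_map l fun i => (φs i).toFun (x i)
    rw [e1, e2] at this
    exact this
  · intro h n k hk x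
    obtain ⟨x', hx'⟩ := exists_dependent_extension (β := fun i => localAlgebra a (I i)) hk x
    have := h (List.ofFn k) (List.nodup_ofFn.mpr hk) x'
    rw [List.map_ofFn, List.map_ofFn, List.prod_ofFn (f := _ ∘ k)] at this
    simpa only [Function.comp_def, hx'] using this

theorem IsFermionAlgebra.exists_isProductExtension {Λ A : Type*} [DecidableEq Λ] [CStarAlgebra A]
    {a : Λ → A} (ha : IsFermionAlgebra a) {ι : Type*} (I : ι → Set Λ)
    (hI : Pairwise fun i j => Disjoint (I i) (I j)) (φs : ∀ i, State (localAlgebra a (I i)))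
    (hev : ∀ i j, ¬ (φs i).IsEven ha → ¬ (φs j).IsEven ha → i = j) :
    ∃ φ : State (localAlgebra a (⋃ i, I i)), IsProductExtension a I φs φ := by
  classical
  choose ω h1 h2 h3 using fun p : Finset Λ × Finset ι =>
    ha.exists_finite_product I hI φs hev p.1 p.2
  -- For fixed finitely localized factors the product formula holds for all large enough pairs
  -- (sites, indices), hence for the limit.
  obtain ⟨L, hL, hL1, hLz⟩ := exists_limit_state (Ultrafilter.of Filter.atTop) ω h1 h2
  obtain ⟨φ, hφ⟩ := State.exists_of_functional (localAlgebra a (⋃ i, I i)) L hL hL1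
  refine ⟨φ, (isProductExtension_iff a I φs φ).mpr fun l hl x => ?_⟩
  rw [hφ, coe_prod_map_inclusion]
  let D : ∀ i, Set (localAlgebra a (I i)) := fun i =>
    {z | (z : A) ∈ {y : A | ∃ F : Finset Λ, y ∈ localAlgebra a (I i ∩ F)}}
  have hD : Dense (Set.pi Set.univ D) := dense_pi Set.univ fun i _ =>
    dense_localAlgebra a (I i) fun y hy => exists_finset_of_mem_adjoin hy
  have hLc : Continuous L := continuous_of_map_star_mul_self_nonneg L hL
  -- Both sides are continuous in the whole family for the product topology, so the formula need
  -- only be checked on the dense set of families with finitely localized members.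
  have hcl : IsClosed {x : ∀ i, localAlgebra a (I i) |
      L (l.map fun i => (x i : A)).prod = (l.map fun i => (φs i).toFun (x i)).prod} := by
    refine isClosed_eq (hLc.comp (continuous_list_prod l fun i _ =>
      continuous_subtype_val.comp (continuous_apply i))) (continuous_list_prod l fun i _ =>
      (continuous_of_positive_on (isClosed_localAlgebra a _) _ (φs i).nonneg).comp
        (continuous_apply i))
  refine (hcl.closure_subset_iff.mpr fun y hy => ?_) (hD x)
  have hy' : ∀ i, ∃ F : Finset Λ, (y i : A) ∈ localAlgebra a (I i ∩ F) := fun i => hy i trivial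
  choose F hF using hy'
  refine hLz _ _ (Ultrafilter.of_le _ ?_)
  refine (Filter.eventually_ge_atTop (l.toFinset.biUnion F, l.toFinset)).mono fun p hp => ?_
  refine h3 p l hl (fun i hi => Or.inl (hp.2 (List.mem_toFinset.mpr hi))) y fun i hi => ?_
  refine localAlgebra_mono a (Set.inter_subset_inter_right _ (Finset.coe_subset.mpr ?_)) (hF i)
  exact (Finset.subset_biUnion_of_mem F (List.mem_toFinset.mpr hi)).trans hp.1

/-! ### Uniqueness: spanning by products of localized elements. -/

section Uniqueness

variable {M A ι : Type*} [CStarAlgebra A] {c : M → A} {T : A →⋆ₐ[ℂ] A}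

/-- `c s` passes each factor standing before index `i`, replacing `x j` by `T (x j)`, and is then
absorbed into the factor at `i`. The list of indices does not change. -/
theorem IsMajorana.exists_gen_mul_prod (h : IsMajorana c T) {J : ι → Set M}
    (hJ : Pairwise fun i j => Disjoint (J i) (J j)) {i : ι} {s : M} (hs : s ∈ J i)
    (l : List ι) (hl : l.Nodup) (hi : i ∈ l) (x : ι → A) (hx : ∀ j, x j ∈ localAlgebra c (J j)) :
    ∃ x' : ι → A, (∀ j, x' j ∈ localAlgebra c (J j)) ∧ c s * (l.map x).prod = (l.map x').prod := by
  classical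
  induction l with
  | nil => simp at hi
  | cons j l ih =>
    rw [List.nodup_cons] at hl
    have hupd : ∀ (x' : ι → A) (y : A), l.map (Function.update x' j y) = l.map x' := fun x' y =>
      List.map_congr_left fun k hk => Function.update_of_ne (ne_of_mem_of_not_mem hk hl.1) _ _
    have hmem : ∀ (x' : ι → A) (y : A), (∀ k, x' k ∈ localAlgebra c (J k)) →
        y ∈ localAlgebra c (J j) → ∀ k, Function.update x' j y k ∈ localAlgebra c (J k) := by
      intro x' y hx' hy k
      rcases eq_or_ne k j with rfl | hk
      · simpa using hy
      · simpa [hk] using hx' k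
    rcases eq_or_ne j i with rfl | hji
    · refine ⟨Function.update x j (c s * x j),
        hmem _ _ hx (mul_mem (mem_localAlgebra hs) (hx j)), ?_⟩
      rw [List.map_cons, List.map_cons, hupd, List.prod_cons, List.prod_cons,
        Function.update_self, mul_assoc]
    · obtain ⟨x', hx', he⟩ := ih hl.2 ((List.mem_cons.mp hi).resolve_left hji.symm)
      refine ⟨Function.update x' j (T (x j)), hmem _ _ hx' (h.map_mem (hx j)), ?_⟩
      have hsj : s ∉ J j := fun hsj => (hJ hji).le_bot ⟨hsj, hs⟩
      rw [List.map_cons, List.map_cons, hupd, List.prod_cons, List.prod_cons,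
        Function.update_self, ← mul_assoc, h.gen_mul hsj (hx j), mul_assoc, he]

/-- The ordered products of localized elements span the algebra generated by a union of disjoint
regions. -/
theorem IsMajorana.adjoin_le_span (h : IsMajorana c T) {J : ι → Set M}
    (hJ : Pairwise fun i j => Disjoint (J i) (J j)) :
    (StarAlgebra.adjoin ℂ (c '' ⋃ i, J i) : Set A) ⊆
      Submodule.span ℂ {y : A | ∃ (l : List ι) (x : ι → A), l.Nodup ∧
        (∀ i, x i ∈ localAlgebra c (J i)) ∧ y = (l.map x).prod} := by
  classical
  set N := Submodule.span ℂ {y : A | ∃ (l : List ι) (x : ι → A), l.Nodup ∧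
        (∀ i, x i ∈ localAlgebra c (J i)) ∧ y = (l.map x).prod} with hN
  -- A generator is absorbed if its index already occurs in the product; otherwise it is prepended
  -- as a new factor.
  have hgen : ∀ s ∈ ⋃ i, J i, ∀ w ∈ N, c s * w ∈ N := by
    intro s hs w hw
    obtain ⟨i, hi⟩ := Set.mem_iUnion.mp hs
    induction hw using Submodule.span_induction with
    | mem w hw =>
      obtain ⟨l, x, hl, hx, rfl⟩ := hw
      by_cases hil : i ∈ l
      · obtain ⟨x', hx', he⟩ := h.exists_gen_mul_prod hJ hi l hl hil x hx
        exact Submodule.subset_span ⟨l, x', hl, hx', he⟩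
      · refine Submodule.subset_span ⟨i :: l, Function.update x i (c s),
          List.nodup_cons.mpr ⟨hil, hl⟩, fun k => ?_, ?_⟩
        · rcases eq_or_ne k i with rfl | hk
          · simpa using mem_localAlgebra hi
          · simpa [hk] using hx k
        · rw [List.map_cons, List.prod_cons, Function.update_self,
            List.map_congr_left fun k hk => Function.update_of_ne (ne_of_mem_of_not_mem hk hil) _ _]
    | zero => simp
    | add u v _ _ hu hv => rw [mul_add]; exact add_mem hu hv
    | smul r u _ hu => rw [mul_smul_comm]; exact N.smul_mem r hu
  have hall : ∀ y ∈ StarAlgebra.adjoin ℂ (c '' ⋃ i, J i), ∀ w ∈ N, y * w ∈ N := by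
    intro y hy
    -- The generators are self-adjoint, so adjoining their adjoints brings nothing new and left
    -- multiplication by generators suffices.
    rw [← StarSubalgebra.mem_toSubalgebra, StarAlgebra.adjoin_toSubalgebra] at hy
    induction hy using Algebra.adjoin_induction with
    | mem y hy =>
      rcases hy with ⟨s, hs, rfl⟩ | ⟨s, hs, he⟩
      · exact hgen s hs
      · rw [← star_star y, ← he, h.star_eq]
        exact hgen s hs
    | algebraMap r =>
      intro w hw
      rw [Algebra.algebraMap_eq_smul_one, smul_mul_assoc, one_mul]
      exact N.smul_mem r hw
    | add u v _ _ hu hv =>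
      intro w hw
      rw [add_mul]
      exact add_mem (hu w hw) (hv w hw)
    | mul u v _ _ hu hv =>
      intro w hw
      rw [mul_assoc]
      exact hu _ (hv w hw)
  intro y hy
  have h1 : (1 : A) ∈ N :=
    Submodule.subset_span ⟨[], fun _ => 1, List.nodup_nil, fun _ => one_mem _, by simp⟩
  simpa using hall y hy 1 h1

end Uniqueness

theorem State.ext {A : Type*} [CStarAlgebra A] {S : StarSubalgebra ℂ A} {φ ψ : State S}
    (h : ∀ x, φ.toFun x = ψ.toFun x) : φ = ψ := by
  cases φ
  cases ψ
  congr
  exact LinearMap.ext h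

theorem IsFermionAlgebra.isProductExtension_unique {Λ A : Type*} [DecidableEq Λ] [CStarAlgebra A]
    {a : Λ → A} (ha : IsFermionAlgebra a) {ι : Type*} (I : ι → Set Λ)
    (hI : Pairwise fun i j => Disjoint (I i) (I j)) (φs : ∀ i, State (localAlgebra a (I i)))
    (φ ψ : State (localAlgebra a (⋃ i, I i))) (hφ : IsProductExtension a I φs φ)
    (hψ : IsProductExtension a I φs ψ) : φ = ψ := by
  rw [isProductExtension_iff] at hφ hψ
  have hspan := ha.isMajorana.adjoin_le_span (J := fun i => Prod.fst ⁻¹' I i)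
    (fun i j hij => (hI hij).preimage Prod.fst)
  simp only [localAlgebra_majorana] at hspan
  have hcl := isClosed_localAlgebra a (⋃ i, I i)
  -- The span lives in `A` while the states live on the subalgebra, so membership is carried along
  -- through the induction.
  have hagree : ∀ y ∈ StarAlgebra.adjoin ℂ (majorana a '' ⋃ i, Prod.fst ⁻¹' I i),
      ∃ hy : y ∈ localAlgebra a (⋃ i, I i), φ.toFun ⟨y, hy⟩ = ψ.toFun ⟨y, hy⟩ := by
    intro y hy'
    have hy := hspan hy'
    rw [SetLike.mem_coe] at hy
    clear hy'
    induction hy using Submodule.span_induction with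
    | mem y hy =>
      obtain ⟨l, x, hl, hx, rfl⟩ := hy
      have e := coe_prod_map_inclusion a I l fun i => ⟨x i, hx i⟩
      rw [← e]
      exact ⟨Subtype.mem _, (hφ l hl fun i => ⟨x i, hx i⟩).trans
        (hψ l hl fun i => ⟨x i, hx i⟩).symm⟩
    | zero => exact ⟨zero_mem _, (map_zero φ.toFun).trans (map_zero ψ.toFun).symm⟩
    | add u v _ _ hu hv =>
      obtain ⟨hu, hu'⟩ := hu
      obtain ⟨hv, hv'⟩ := hv
      refine ⟨add_mem hu hv, ?_⟩
      exact (map_add φ.toFun ⟨u, hu⟩ ⟨v, hv⟩).trans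
        ((congrArg₂ _ hu' hv').trans (map_add ψ.toFun ⟨u, hu⟩ ⟨v, hv⟩).symm)
    | smul r u _ hu =>
      obtain ⟨hu, hu'⟩ := hu
      refine ⟨StarSubalgebra.smul_mem _ hu r, ?_⟩
      exact (map_smul φ.toFun r ⟨u, hu⟩).trans
        ((congrArg _ hu').trans (map_smul ψ.toFun r ⟨u, hu⟩).symm)
  have hset : {x : localAlgebra a (⋃ i, I i) | φ.toFun x = ψ.toFun x} = Set.univ := by
    refine (isClosed_eq (continuous_of_positive_on hcl _ φ.nonneg)
      (continuous_of_positive_on hcl _ ψ.nonneg)).closure_eq.symm.trans (Dense.closure_eq ?_)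
    have hd := dense_localAlgebra (majorana a) (⋃ i, Prod.fst ⁻¹' I i) (Set.Subset.refl _)
    rw [← Set.preimage_iUnion] at hd hagree
    rw [localAlgebra_majorana] at hd
    exact hd.mono fun x hx => (hagree x hx).2
  exact State.ext fun x => hset.ge (Set.mem_univ x)

end FermionLattice

theorem mainTheorem10 {ν : ℕ} {A : Type*} [CStarAlgebra A]
    (a : (Fin ν → ℤ) → A) (ha : FermionLattice.IsFermionAlgebra a)
    {ι : Type*} (I : ι → Set (Fin ν → ℤ)) (hI : Pairwise fun i j => Disjoint (I i) (I j))
    (φs : ∀ i, FermionLattice.State (FermionLattice.localAlgebra a (I i))) :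
    ((∀ i j, ¬ (φs i).IsEven ha → ¬ (φs j).IsEven ha → i = j) →
      ∃ φ : FermionLattice.State (FermionLattice.localAlgebra a (⋃ i, I i)),
        FermionLattice.IsProductExtension a I φs φ) ∧
    (∀ φ ψ : FermionLattice.State (FermionLattice.localAlgebra a (⋃ i, I i)),
      FermionLattice.IsProductExtension a I φs φ →
      FermionLattice.IsProductExtension a I φs ψ → φ = ψ) := by
  exact ⟨ha.exists_isProductExtension I hI φs, ha.isProductExtension_unique I hI φs⟩
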